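/- All algebras are complex, associative and unital. Call a $*$-algebra residually finite-dimensional (RFD) if it admits an injective unital $*$-homomorphism into a (possibly infinite) product of matrix algebras $\prod_{i\in I} M_{n_i}(\mathbb{C})$. Let $\mathcal{B}$ be an RFD $*$-algebra, let $\mathcal{D}\subset\mathcal{B}$ be a finite-dimensional commutative $*$-subalgebra (automatically a C$^*$-algebra, because $\mathcal{B}$ is RFD; it need not contain the unit of $\mathcal{B}$), and let $\mathcal{C}$ be a finite-dimensional C$^*$-algebra. Let $\mathcal{C}*\mathcal{B}$ be the free product (the coproduct of unital $*$-algebras), and let $[\mathcal{C},\mathcal{D}]$ denote the two-sided ideal of it generated by all commutators $cd-dc$ with $c\in\mathcal{C}$, $d\in\mathcal{D}$. Then the quotient $*$-algebra $$\mathcal{C}*\mathcal{B}/[\mathcal{C},\mathcal{D}]$$ is RFD. -/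

import Mathlib

/-- A (complex, unital) `*`-algebra is residually finite-dimensional if it embeds, as a unital
`*`-algebra, in a possibly infinite product of matrix algebras `M_n(ℂ)`.  The index type may be
taken in the universe of `A`, because for each nonzero element of `A` one factor suffices. -/
def IsRFD.{u} (A : Type u) [Ring A] [Algebra ℂ A] [StarRing A] : Prop :=
  ∃ (ι : Type u) (n : ι → ℕ)
    (φ : A →⋆ₐ[ℂ] ((i : ι) → Matrix (Fin (n i)) (Fin (n i)) ℂ)), Function.Injective φ

section FreeProduct

universe u v w

variable (A : Type u) (B : Type v) [Ring A] [Algebra ℂ A] [Ring B] [Algebra ℂ B]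

/-- The relations that turn the two inclusions of generators `A → ℂ⟨A ⊔ B⟩` and
`B → ℂ⟨A ⊔ B⟩` into homomorphisms of unital `ℂ`-algebras. -/
inductive FreeProdRel : FreeAlgebra ℂ (A ⊕ B) → FreeAlgebra ℂ (A ⊕ B) → Prop
  | inl_algebraMap (z : ℂ) :
      FreeProdRel (FreeAlgebra.ι ℂ (Sum.inl (algebraMap ℂ A z))) (algebraMap ℂ _ z)
  | inl_add (a a' : A) :
      FreeProdRel (FreeAlgebra.ι ℂ (Sum.inl (a + a')))
        (FreeAlgebra.ι ℂ (Sum.inl a) + FreeAlgebra.ι ℂ (Sum.inl a'))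
  | inl_mul (a a' : A) :
      FreeProdRel (FreeAlgebra.ι ℂ (Sum.inl (a * a')))
        (FreeAlgebra.ι ℂ (Sum.inl a) * FreeAlgebra.ι ℂ (Sum.inl a'))
  | inr_algebraMap (z : ℂ) :
      FreeProdRel (FreeAlgebra.ι ℂ (Sum.inr (algebraMap ℂ B z))) (algebraMap ℂ _ z)
  | inr_add (b b' : B) :
      FreeProdRel (FreeAlgebra.ι ℂ (Sum.inr (b + b')))
        (FreeAlgebra.ι ℂ (Sum.inr b) + FreeAlgebra.ι ℂ (Sum.inr b'))
  | inr_mul (b b' : B) :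
      FreeProdRel (FreeAlgebra.ι ℂ (Sum.inr (b * b')))
        (FreeAlgebra.ι ℂ (Sum.inr b) * FreeAlgebra.ι ℂ (Sum.inr b'))

/-- The free product `A * B` of two unital complex algebras, that is, their coproduct. -/
def FreeProd : Type (max u v) := RingQuot (FreeProdRel A B)

namespace FreeProd

noncomputable instance : Ring (FreeProd A B) := inferInstanceAs (Ring (RingQuot (FreeProdRel A B)))

noncomputable instance : Algebra ℂ (FreeProd A B) :=
  inferInstanceAs (Algebra ℂ (RingQuot (FreeProdRel A B)))

/-- The quotient map from the free algebra on `A ⊔ B`. -/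
noncomputable def mk : FreeAlgebra ℂ (A ⊕ B) →ₐ[ℂ] FreeProd A B :=
  RingQuot.mkAlgHom ℂ (FreeProdRel A B)

variable {A B}

theorem mk_rel {x y : FreeAlgebra ℂ (A ⊕ B)} (h : FreeProdRel A B x y) : mk A B x = mk A B y :=
  RingQuot.mkAlgHom_rel ℂ h

variable (A B)

/-- The canonical homomorphism `A → A * B`. -/
noncomputable def inl : A →ₐ[ℂ] FreeProd A B where
  toFun a := mk A B (FreeAlgebra.ι ℂ (Sum.inl a))
  map_one' := by
    have h := mk_rel (FreeProdRel.inl_algebraMap (A := A) (B := B) 1)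
    simpa using h
  map_zero' := by
    have h := mk_rel (FreeProdRel.inl_algebraMap (A := A) (B := B) 0)
    simpa using h
  map_mul' a a' := by rw [mk_rel (FreeProdRel.inl_mul a a'), map_mul]
  map_add' a a' := by rw [mk_rel (FreeProdRel.inl_add a a'), map_add]
  commutes' z := by rw [mk_rel (FreeProdRel.inl_algebraMap z), AlgHom.commutes]

/-- The canonical homomorphism `B → A * B`. -/
noncomputable def inr : B →ₐ[ℂ] FreeProd A B where
  toFun b := mk A B (FreeAlgebra.ι ℂ (Sum.inr b))
  map_one' := by
    have h := mk_rel (FreeProdRel.inr_algebraMap (A := A) (B := B) 1)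
    simpa using h
  map_zero' := by
    have h := mk_rel (FreeProdRel.inr_algebraMap (A := A) (B := B) 0)
    simpa using h
  map_mul' b b' := by rw [mk_rel (FreeProdRel.inr_mul b b'), map_mul]
  map_add' b b' := by rw [mk_rel (FreeProdRel.inr_add b b'), map_add]
  commutes' z := by rw [mk_rel (FreeProdRel.inr_algebraMap z), AlgHom.commutes]

variable {A B}

/-- Existence in the universal property of the free product. -/
noncomputable def lift {P : Type w} [Ring P] [Algebra ℂ P] (f : A →ₐ[ℂ] P) (g : B →ₐ[ℂ] P) :
    FreeProd A B →ₐ[ℂ] P :=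
  RingQuot.liftAlgHom ℂ ⟨FreeAlgebra.lift ℂ (Sum.elim f g), by
    intro x y h
    cases h <;> simp⟩

@[simp]
theorem lift_inl {P : Type w} [Ring P] [Algebra ℂ P] (f : A →ₐ[ℂ] P) (g : B →ₐ[ℂ] P) (a : A) :
    lift f g (inl A B a) = f a := by
  change RingQuot.liftAlgHom ℂ _ (RingQuot.mkAlgHom ℂ _ _) = _
  simp

@[simp]
theorem lift_inr {P : Type w} [Ring P] [Algebra ℂ P] (f : A →ₐ[ℂ] P) (g : B →ₐ[ℂ] P) (b : B) :
    lift f g (inr A B b) = g b := by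
  change RingQuot.liftAlgHom ℂ _ (RingQuot.mkAlgHom ℂ _ _) = _
  simp

/-- `A * B` is generated, as a ring, by the images of `A` and `B`. -/
@[elab_as_elim]
theorem induction {p : FreeProd A B → Prop} (x : FreeProd A B)
    (hl : ∀ a, p (inl A B a)) (hr : ∀ b, p (inr A B b))
    (hadd : ∀ x y, p x → p y → p (x + y)) (hmul : ∀ x y, p x → p y → p (x * y)) : p x := by
  obtain ⟨x, rfl⟩ := RingQuot.mkAlgHom_surjective ℂ (FreeProdRel A B) x
  change p (mk A B x)
  induction x using FreeAlgebra.induction with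
  | grade0 z =>
    have h := hl (algebraMap ℂ A z)
    rwa [AlgHom.commutes, ← AlgHom.commutes (mk A B)] at h
  | grade1 s =>
    cases s with
    | inl a => exact hl a
    | inr b => exact hr b
  | mul x y hx hy => rw [map_mul]; exact hmul _ _ hx hy
  | add x y hx hy => rw [map_add]; exact hadd _ _ hx hy

/-- Uniqueness in the universal property of the free product. -/
theorem hom_ext {P : Type w} [Ring P] [Algebra ℂ P] {f g : FreeProd A B →ₐ[ℂ] P}
    (hl : ∀ a, f (inl A B a) = g (inl A B a)) (hr : ∀ b, f (inr A B b) = g (inr A B b)) :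
    f = g := by
  ext x
  induction x using FreeProd.induction with
  | hl a => exact hl a
  | hr b => exact hr b
  | hadd x y hx hy => rw [map_add, map_add, hx, hy]
  | hmul x y hx hy => rw [map_mul, map_mul, hx, hy]

end FreeProd

/-! ### The involution of the free product -/

/-- The opposite ring of a complex algebra, with the conjugate scalar multiplication: an algebra
homomorphism into it is a conjugate-linear antihomomorphism. -/
def ConjOpp (P : Type w) : Type w := Pᵐᵒᵖ

namespace ConjOpp

variable {P : Type w} [Ring P] [Algebra ℂ P]

instance : Ring (ConjOpp P) := inferInstanceAs (Ring Pᵐᵒᵖ)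

noncomputable instance : Algebra ℂ (ConjOpp P) :=
  RingHom.toAlgebra' ((algebraMap ℂ Pᵐᵒᵖ).comp (starRingEnd ℂ))
    (fun z (x : Pᵐᵒᵖ) => Algebra.commutes (starRingEnd ℂ z) x)

/-- The identity map, forgetting the opposite multiplication. -/
def out (x : ConjOpp P) : P := MulOpposite.unop x

/-- If `f` is a homomorphism of `*`-algebras then `x ↦ f (star x)` is a homomorphism into the
conjugate opposite algebra. -/
noncomputable def starComp {Q : Type*} [Ring Q] [Algebra ℂ Q] [StarRing Q] [StarModule ℂ Q]
    (f : Q →ₐ[ℂ] P) : Q →ₐ[ℂ] ConjOpp P where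
  toFun x := (MulOpposite.op (f (star x)) : Pᵐᵒᵖ)
  map_one' := by rw [star_one, map_one]; rfl
  map_zero' := by rw [star_zero, map_zero]; rfl
  map_mul' x y := by rw [star_mul, map_mul]; rfl
  map_add' x y := by rw [star_add, map_add]; rfl
  commutes' z := by
    rw [← algebraMap_star_comm, AlgHom.commutes]; rfl

end ConjOpp

namespace FreeProd

variable {A B}
variable [StarRing A] [StarModule ℂ A] [StarRing B] [StarModule ℂ B]

/-- The involution of `A * B` extends those of `A` and `B`. -/
noncomputable instance : Star (FreeProd A B) where
  star x := ConjOpp.out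
    (lift (ConjOpp.starComp (inl A B)) (ConjOpp.starComp (inr A B)) x)

theorem star_inl (a : A) : star (inl A B a) = inl A B (star a) := by
  change ConjOpp.out (lift _ _ (inl A B a)) = _
  rw [lift_inl]; rfl

theorem star_inr (b : B) : star (inr A B b) = inr A B (star b) := by
  change ConjOpp.out (lift _ _ (inr A B b)) = _
  rw [lift_inr]; rfl

theorem star_add' (x y : FreeProd A B) : star (x + y) = star x + star y := by
  change ConjOpp.out (lift _ _ (x + y)) = _
  rw [map_add]; rfl

theorem star_mul' (x y : FreeProd A B) : star (x * y) = star y * star x := by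
  change ConjOpp.out (lift _ _ (x * y)) = _
  rw [map_mul]; rfl

theorem star_star' (x : FreeProd A B) : star (star x) = x := by
  induction x using FreeProd.induction with
  | hl a => rw [star_inl, star_inl, star_star]
  | hr b => rw [star_inr, star_inr, star_star]
  | hadd x y hx hy => rw [star_add', star_add', hx, hy]
  | hmul x y hx hy => rw [star_mul', star_mul', hx, hy]

noncomputable instance : StarRing (FreeProd A B) where
  star_involutive := star_star'
  star_mul := star_mul'
  star_add := star_add'

instance : StarModule ℂ (FreeProd A B) where
  star_smul z x := by
    rw [Algebra.smul_def, star_mul, Algebra.smul_def, ← AlgHom.commutes (inl A B),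
      star_inl, ← algebraMap_star_comm, AlgHom.commutes, Algebra.commutes]

end FreeProd

/-! ### The quotient by commutators -/

variable {A B}
variable [StarRing A] [StarModule ℂ A] [StarRing B] [StarModule ℂ B]

/-- The relations `a b = b a` in `A * B`, for `a ∈ A` and `b ∈ D ⊆ B`, in both orders. -/
inductive CommutatorRel (D : NonUnitalStarSubalgebra ℂ B) :
    FreeProd A B → FreeProd A B → Prop
  | comm (a : A) (b : B) (hb : b ∈ D) : CommutatorRel D
      (FreeProd.inl A B a * FreeProd.inr A B b) (FreeProd.inr A B b * FreeProd.inl A B a)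
  | comm_symm (a : A) (b : B) (hb : b ∈ D) : CommutatorRel D
      (FreeProd.inr A B b * FreeProd.inl A B a) (FreeProd.inl A B a * FreeProd.inr A B b)

theorem CommutatorRel.star (D : NonUnitalStarSubalgebra ℂ B) (x y : FreeProd A B)
    (h : CommutatorRel D x y) : CommutatorRel D (star x) (star y) := by
  cases h with
  | comm a b hb =>
    rw [star_mul, star_mul, FreeProd.star_inl, FreeProd.star_inr]
    exact .comm_symm _ _ (star_mem hb)
  | comm_symm a b hb =>
    rw [star_mul, star_mul, FreeProd.star_inl, FreeProd.star_inr]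
    exact .comm _ _ (star_mem hb)

variable (A)

/-- The `*`-algebra `A * B / [A, D]`: the quotient of the free product by the two-sided ideal
generated by the commutators `a d - d a` with `a ∈ A` and `d ∈ D`. -/
def FreeProdModComm (D : NonUnitalStarSubalgebra ℂ B) : Type (max u v) :=
  RingQuot (CommutatorRel (A := A) D)

namespace FreeProdModComm

variable (D : NonUnitalStarSubalgebra ℂ B)

noncomputable instance : Ring (FreeProdModComm A D) :=
  inferInstanceAs (Ring (RingQuot (CommutatorRel (A := A) D)))

noncomputable instance : Algebra ℂ (FreeProdModComm A D) :=
  inferInstanceAs (Algebra ℂ (RingQuot (CommutatorRel (A := A) D)))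

noncomputable instance : StarRing (FreeProdModComm A D) :=
  RingQuot.starRing (CommutatorRel (A := A) D) (CommutatorRel.star D)

/-- The quotient map `A * B → A * B / [A, D]`. -/
noncomputable def mk : FreeProd A B →ₐ[ℂ] FreeProdModComm A D :=
  RingQuot.mkAlgHom ℂ (CommutatorRel (A := A) D)

theorem star_mk (x : FreeProd A B) : star (mk A D x) = mk A D (star x) := by
  simp only [mk, RingQuot.mkAlgHom_def, RingQuot.mkRingHom_def]
  rfl

instance : StarModule ℂ (FreeProdModComm A D) where
  star_smul z x := by
    obtain ⟨x, rfl⟩ := RingQuot.mkAlgHom_surjective ℂ (CommutatorRel (A := A) D) x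
    change star (z • mk A D x) = star z • star (mk A D x)
    rw [← map_smul, star_mk, star_mk, star_smul, map_smul]

end FreeProdModComm

end FreeProduct

/-!
The proof works for every residually finite-dimensional `C`.  Let `A = C * B / [C, D]`, and let
`x ∈ A` be null, that is, annihilated by all finite-dimensional `*`-representations of `A`.  The
span of the words `b₀ c₁ b₁ ⋯ cₖ bₖ` in `A` is called `wordImage k`; these spaces exhaust `A`.  The
point is that a null `x` in `wordImage (k + 1)` lies in `wordImage k`, and vanishes if it lies in
`wordImage 0`.

Representations of `B` and `C` on one space, with commuting images of `C` and `D`, give a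
`*`-representation of `A`, in which that of `C` may be conjugated by any unitary in the commutant of
`D`.  By analytic continuation (`wordHom_exp_eq_zero`) `x` is also annihilated when the unitary is
replaced by an invertible element `exp W` of the commutant.  If `Y` is a square-zero element of the
commutant, then conjugation by `exp (t Y) = 1 + t Y` is quadratic in `t`, with leading coefficient
`c ↦ -Y c Y`.  The coefficient of `t ^ (2 k)` is therefore obtained from the words by replacing each
letter `c` by `-Y c Y`, and it vanishes (`IsLinked.leadingHom_eq_zero`).  The replacement kills all
words in which a letter `c` is scalar or an inner letter `b` is in `D`.

Conversely, a combination of words on which all such leading coefficients vanish reduces to shorter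
words (`inr_mul_ofWord_mem_shorterWords`).  Taking for `Y` a sum of rank-one operators that link
different summands of a direct sum, one obtains as leading coefficients all products of vector
functionals `⟪α₀, b₀ β₀⟫ ⟪γ₁, c₁ δ₁⟫ ⟪α₁, b₁ β₁⟫ ⋯` in which `βᵢ` and `αᵢ₊₁` belong to the same
minimal projection of `ℂ 1 + D`, `γᵢ ⟂ δᵢ`, and `αᵢ ⟂ βᵢ` for `0 < i < k` (`IsLeftNull.contract`).
The orthogonality makes `Y` square-zero.  Such functionals separate the letters modulo the scalars
and modulo `D` (`exists_mul_mul_eq_smul_of_vectorFunctionals`), which is what the reduction needs.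

A finite-dimensional C⋆-algebra is residually finite-dimensional by its regular representation.
-/

open Matrix
open scoped ComplexOrder Kronecker

/-! ### Residually finite-dimensional algebras -/

section RFD

variable {R : Type*} [Ring R] [Algebra ℂ R] [StarRing R]

/-- An element is null if all finite-dimensional `*`-representations annihilate it. -/
def IsNull (x : R) : Prop :=
  ∀ (n : ℕ) (π : R →⋆ₐ[ℂ] Matrix (Fin n) (Fin n) ℂ), π x = 0

theorem IsRFD.eq_zero_of_isNull (h : IsRFD R) {x : R} (hx : IsNull x) : x = 0 := by
  obtain ⟨ι, n, φ, hφ⟩ := h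
  apply hφ
  rw [map_zero]
  funext i
  exact hx (n i) ((Pi.evalStarAlgHom ℂ (fun i => Matrix (Fin (n i)) (Fin (n i)) ℂ) i).comp φ)

theorem IsRFD.of_isNull (h : ∀ x : R, IsNull x → x = 0) : IsRFD R := by
  have h' : ∀ x : {x : R // x ≠ 0}, ∃ (n : ℕ) (π : R →⋆ₐ[ℂ] Matrix (Fin n) (Fin n) ℂ),
      π x ≠ 0 := by
    rintro ⟨x, hx⟩
    by_contra! hc
    exact hx (h x hc)
  choose n π hπ using h'
  refine ⟨{x : R // x ≠ 0}, n,
    { toFun := fun x i => π i x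
      map_one' := by funext i; exact map_one _
      map_mul' := fun x y => by funext i; exact map_mul _ _ _
      map_zero' := by funext i; exact map_zero _
      map_add' := fun x y => by funext i; exact map_add _ _ _
      commutes' := fun z => by funext i; exact AlgHomClass.commutes (π i) z
      map_star' := fun x => by funext i; exact map_star (π i) x }, ?_⟩
  rw [injective_iff_map_eq_zero]
  intro x hx
  by_contra hne
  exact hπ ⟨x, hne⟩ (congrFun hx ⟨x, hne⟩)

/-- Transport of matrix representations along a bijection of index sets. -/
def reindexStarAlgHom {m n : Type*} [Fintype m] [DecidableEq m] [Fintype n] [DecidableEq n]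
    (e : m ≃ n) : Matrix m m ℂ →⋆ₐ[ℂ] Matrix n n ℂ where
  __ := (reindexAlgEquiv ℂ ℂ e).toAlgHom
  map_star' x := by
    ext i j
    simp [star_apply]

theorem IsNull.map_eq_zero {x : R} (hx : IsNull x) {ι : Type*} [Fintype ι] [DecidableEq ι]
    (π : R →⋆ₐ[ℂ] Matrix ι ι ℂ) : π x = 0 := by
  have h := hx _ ((reindexStarAlgHom (Fintype.equivFin ι)).comp π)
  exact (reindexAlgEquiv ℂ ℂ (Fintype.equivFin ι)).injective (h.trans (map_zero _).symm)

theorem IsRFD.eq_zero_of_star_mul_self (h : IsRFD R) {x : R} (hx : star x * x = 0) : x = 0 := by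
  refine h.eq_zero_of_isNull fun n π => ?_
  have := congrArg π hx
  rw [map_mul, map_star, map_zero] at this
  exact conjTranspose_mul_self_eq_zero.1 this

/-- Normal elements of square zero vanish. -/
theorem IsRFD.eq_zero_of_commute_star (h : IsRFD R) {x : R} (hc : star x * x = x * star x)
    (hx : x * x = 0) : x = 0 := by
  apply h.eq_zero_of_star_mul_self
  apply h.eq_zero_of_star_mul_self
  calc star (star x * x) * (star x * x) = star x * (x * star x) * x := by
        rw [star_mul, star_star]; noncomm_ring
    _ = star x * star x * (x * x) := by rw [← hc]; noncomm_ring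
    _ = 0 := by rw [hx, mul_zero]

end RFD

/-! ### Finite-dimensional C⋆-algebras -/

/-- The Gelfand–Naimark–Segal construction in finite dimension: left multiplication is a
faithful `*`-representation for the inner product `⟪x, y⟫ = τ (x⋆ y)`. -/
theorem IsRFD.of_faithful_functional {R : Type*} [Ring R] [Algebra ℂ R] [StarRing R]
    [StarModule ℂ R] [FiniteDimensional ℂ R] (τ : R →ₗ[ℂ] ℂ)
    (hpos : ∀ x, 0 ≤ τ (star x * x)) (hτ : ∀ x, τ (star x * x) = 0 → x = 0) : IsRFD R := by
  let core : InnerProductSpace.Core ℂ R :=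
    { inner := fun x y => τ (star x * y)
      conj_inner_symm := fun x y => by
        -- polarisation: a functional that is real on all `star z * z` is Hermitian
        have hre : ∀ z : R, starRingEnd ℂ (τ (star z * z)) = τ (star z * z) := fun z =>
          Complex.conj_eq_iff_im.2 (Complex.nonneg_iff.1 (hpos z)).2.symm
        have h1 := hre (x + y)
        have h2 := hre (x + Complex.I • y)
        simp only [star_add, star_smul, add_mul, mul_add, map_add, hre, smul_mul_assoc,
          mul_smul_comm, map_smul, smul_eq_mul, map_mul, Complex.star_def, Complex.conj_I,
          map_neg, neg_neg] at h1 h2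
        linear_combination (1 / 2 : ℂ) * h1 - (Complex.I / 2) * h2 +
          (1 / 2 : ℂ) * (starRingEnd ℂ (τ (star y * x)) - starRingEnd ℂ (τ (star x * y)) -
            τ (star x * y) + τ (star y * x)) * Complex.I_mul_I
      re_inner_nonneg := fun x => (Complex.nonneg_iff.1 (hpos x)).1
      add_left := fun x y z => by simp [add_mul]
      smul_left := fun x y r => by simp
      definite := fun x hx => hτ x hx }
  let _ : NormedAddCommGroup R := core.toNormedAddCommGroup
  let _ : InnerProductSpace ℂ R := InnerProductSpace.ofCore core.toCore
  let b := stdOrthonormalBasis ℂ R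
  refine IsRFD.of_isNull fun x hx => ?_
  have hadj : ∀ y : R, Algebra.lmul ℂ R (star y) = star (Algebra.lmul ℂ R y) := fun y => by
    rw [LinearMap.star_eq_adjoint, LinearMap.eq_adjoint_iff]
    intro u v
    change τ (star (star y * u) * v) = τ (star u * (y * v))
    rw [star_mul, star_star, mul_assoc]
  let L : R →⋆ₐ[ℂ] Module.End ℂ R := { Algebra.lmul ℂ R with map_star' := hadj }
  have h := hx _ (((LinearMap.toMatrixOrthonormal b).toStarAlgHom).comp L)
  have h' : Algebra.lmul ℂ R x = 0 :=
    (LinearMap.toMatrixOrthonormal b).injective (h.trans (map_zero _).symm)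
  simpa using congrArg (fun f : Module.End ℂ R => f 1) h'

section CStar

variable {C : Type*} [CStarAlgebra C] [FiniteDimensional ℂ C]

/-- The trace of left multiplication. -/
noncomputable def regularTrace : C →ₗ[ℂ] ℂ :=
  LinearMap.trace ℂ C ∘ₗ (Algebra.lmul ℂ C).toLinearMap

theorem regularTrace_eq_sum (x : C) :
    regularTrace x = (LinearMap.charpoly (Algebra.lmul ℂ C x)).roots.sum :=
  Module.End.trace_eq_sum_roots_charpoly_of_splits (IsAlgClosed.splits _)

theorem mem_spectrum_of_mem_charpoly_roots {x : C} {μ : ℂ}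
    (hμ : μ ∈ (LinearMap.charpoly (Algebra.lmul ℂ C x)).roots) : μ ∈ spectrum ℂ x := by
  have h1 := (Module.End.hasEigenvalue_iff_isRoot_charpoly _ _).2
    (Polynomial.isRoot_of_mem_roots hμ)
  obtain ⟨v, hv⟩ := h1.exists_hasEigenvector
  intro hu
  have h2 : (algebraMap ℂ C μ - x) * v = 0 := by
    have := hv.apply_eq_smul
    simp only [Algebra.coe_lmul_eq_mul, LinearMap.mul_apply'] at this
    rw [sub_mul, this, Algebra.smul_def, sub_self]
  exact hv.2 ((IsUnit.mul_right_eq_zero hu).1 h2)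

theorem nonneg_of_mem_charpoly_roots {x : C} {μ : ℂ}
    (hμ : μ ∈ (LinearMap.charpoly (Algebra.lmul ℂ C (star x * x))).roots) : 0 ≤ μ := by
  let _ := CStarAlgebra.spectralOrder C
  have _ := CStarAlgebra.spectralOrderedRing C
  exact spectrum_nonneg_of_nonneg (star_mul_self_nonneg x) (mem_spectrum_of_mem_charpoly_roots hμ)

theorem regularTrace_nonneg (x : C) : 0 ≤ regularTrace (star x * x) := by
  rw [regularTrace_eq_sum]
  exact Multiset.sum_nonneg fun μ hμ => nonneg_of_mem_charpoly_roots hμ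

/-- All eigenvalues of left multiplication by `star x * x` are nonnegative, so if their sum vanishes
then `star x * x` is a nilpotent self-adjoint element. -/
theorem eq_zero_of_regularTrace {x : C} (hx : regularTrace (star x * x) = 0) : x = 0 := by
  rw [regularTrace_eq_sum] at hx
  have h0 : ∀ μ ∈ (LinearMap.charpoly (Algebra.lmul ℂ C (star x * x))).roots, μ = 0 := by
    intro μ hμ
    refine le_antisymm ?_ (nonneg_of_mem_charpoly_roots hμ)
    rw [← hx]
    exact Multiset.single_le_sum (fun μ hμ => nonneg_of_mem_charpoly_roots hμ) _ hμ
  -- all eigenvalues of left multiplication vanish, so `star x * x` is nilpotent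
  have hX : LinearMap.charpoly (Algebra.lmul ℂ C (star x * x)) =
      Polynomial.X ^ (Multiset.card (LinearMap.charpoly (Algebra.lmul ℂ C (star x * x))).roots) := by
    conv_lhs => rw [(IsAlgClosed.splits (LinearMap.charpoly (Algebra.lmul ℂ C
      (star x * x)))).eq_prod_roots_of_monic (LinearMap.charpoly_monic _)]
    rw [Multiset.eq_replicate_card.2 h0]
    simp
  have hn := LinearMap.aeval_self_charpoly (Algebra.lmul ℂ C (star x * x))
  rw [hX, map_pow, Polynomial.aeval_X, ← map_pow] at hn
  have hnil : (star x * x) ^ (Multiset.card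
      (LinearMap.charpoly (Algebra.lmul ℂ C (star x * x))).roots) = 0 := by
    simpa using congrArg (fun f : Module.End ℂ C => f 1) hn
  have hsa : IsSelfAdjoint (star x * x) := IsSelfAdjoint.star_mul_self x
  have hz : star x * x = 0 := by
    have := hsa.spectralRadius_eq_nnnorm
    have hs : spectrum ℂ (star x * x) ⊆ {0} := by
      intro μ hμ
      have hmem := spectrum.pow_mem_pow (star x * x) (Multiset.card
        (LinearMap.charpoly (Algebra.lmul ℂ C (star x * x))).roots) hμ
      rw [hnil] at hmem
      rcases subsingleton_or_nontrivial C with hC | hC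
      · simp at hmem
      · rw [spectrum.zero_eq] at hmem
        exact pow_eq_zero_iff (by
          rintro h; rw [h, pow_zero] at hnil; exact one_ne_zero hnil) |>.1 hmem
    have hr : spectralRadius ℂ (star x * x) = 0 := by
      simp only [spectralRadius]
      refine le_antisymm (iSup₂_le fun μ hμ => ?_) bot_le
      rw [hs hμ]; simp
    rw [hr] at this
    simpa using this.symm
  exact CStarRing.star_mul_self_eq_zero_iff _ |>.1 hz

/-- The regular trace is a faithful positive functional, so the regular representation is a
faithful `*`-representation. -/
theorem isRFD_of_finiteDimensional : IsRFD C :=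
  IsRFD.of_faithful_functional regularTrace regularTrace_nonneg
    fun _ => eq_zero_of_regularTrace

end CStar

/-! ### Minimal projections of a commutative finite-dimensional `*`-subalgebra -/

section Projections

universe u

variable {B : Type u} [Ring B] [Algebra ℂ B] [StarRing B] [StarModule ℂ B]

/-- The unitization `ℂ 1 + D` of `D` inside `B`. -/
def unitization (D : NonUnitalStarSubalgebra ℂ B) : StarSubalgebra ℂ B where
  carrier := {x | ∃ z : ℂ, ∃ d ∈ D, x = algebraMap ℂ B z + d}
  mul_mem' := by
    rintro _ _ ⟨z, d, hd, rfl⟩ ⟨w, e, he, rfl⟩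
    refine ⟨z * w, z • e + w • d + d * e, add_mem (add_mem (SMulMemClass.smul_mem _ he)
      (SMulMemClass.smul_mem _ hd)) (mul_mem hd he), ?_⟩
    rw [add_mul, mul_add, mul_add, map_mul, ← Algebra.commutes w d, Algebra.smul_def,
      Algebra.smul_def, add_assoc, add_assoc]
  add_mem' := by
    rintro _ _ ⟨z, d, hd, rfl⟩ ⟨w, e, he, rfl⟩
    exact ⟨z + w, d + e, add_mem hd he, by rw [map_add]; abel⟩
  algebraMap_mem' z := ⟨z, 0, zero_mem _, by simp⟩
  star_mem' := by
    rintro _ ⟨z, d, hd, rfl⟩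
    exact ⟨star z, star d, star_mem hd, by rw [star_add, algebraMap_star_comm]⟩

theorem unitization_comm {D : NonUnitalStarSubalgebra ℂ B}
    (hD : ∀ x ∈ D, ∀ y ∈ D, x * y = y * x) {x y : B} (hx : x ∈ unitization D)
    (hy : y ∈ unitization D) : x * y = y * x := by
  obtain ⟨z, d, hd, rfl⟩ := hx
  obtain ⟨w, e, he, rfl⟩ := hy
  rw [add_mul, mul_add, mul_add, add_mul, mul_add, mul_add, hD d hd e he,
    Algebra.commutes z e, ← Algebra.commutes w d, Algebra.commutes z]
  abel

theorem finiteDimensional_unitization (D : NonUnitalStarSubalgebra ℂ B)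
    [FiniteDimensional ℂ D] : FiniteDimensional ℂ (unitization D) := by
  let f : (ℂ × D) →ₗ[ℂ] B :=
    (Algebra.linearMap ℂ B).coprod D.toNonUnitalSubalgebra.toSubmodule.subtype
  have h : (Subalgebra.toSubmodule (unitization D).toSubalgebra) ≤ LinearMap.range f := by
    rintro _ ⟨z, d, hd, rfl⟩
    exact ⟨(z, ⟨d, hd⟩), rfl⟩
  exact Submodule.finiteDimensional_of_le h

/-- The minimal projections of `ℂ 1 + D`: a finite family of orthogonal projections with sum `1`,
on each of which the elements of `D` are scalars. -/
theorem exists_projections (hB : IsRFD B) (D : NonUnitalStarSubalgebra ℂ B)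
    [FiniteDimensional ℂ D] (hD : ∀ x ∈ D, ∀ y ∈ D, x * y = y * x) :
    ∃ (I : Type u) (_ : Fintype I) (p : I → B),
      (∀ i, star (p i) = p i) ∧ (∀ i, p i * p i = p i) ∧ (∀ i j, i ≠ j → p i * p j = 0) ∧
      ∑ i, p i = 1 ∧ (∀ i, ∃ z : ℂ, ∃ d ∈ D, p i = algebraMap ℂ B z + d) ∧
      ∀ d ∈ D, ∀ i, ∃ z : ℂ, d * p i = z • p i ∧ p i * d = z • p i := by
  let S := unitization D
  have : FiniteDimensional ℂ S := finiteDimensional_unitization D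
  let _ : CommRing S :=
    { (inferInstance : Ring S) with
      mul_comm := fun x y => Subtype.ext (unitization_comm hD x.2 y.2) }
  have : IsArtinianRing S := IsArtinianRing.of_finite ℂ S
  have : IsReduced S := by
    rw [isReduced_iff_pow_one_lt 2 one_lt_two]
    intro x hx
    apply Subtype.ext
    refine hB.eq_zero_of_commute_star (unitization_comm hD (star_mem x.2) x.2) ?_
    simpa [pow_two] using congrArg Subtype.val hx
  let _ : Fintype (MaximalSpectrum S) := Fintype.ofFinite _
  classical
  let e := IsArtinianRing.equivPi S
  let q : MaximalSpectrum S → S := fun m => e.symm (Pi.single m 1)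
  have heq : ∀ m, e (q m) = Pi.single m 1 := fun m => e.apply_symm_apply _
  have hqq : ∀ m, q m * q m = q m := fun m => e.injective (by
    rw [map_mul, heq, ← Pi.single_mul, one_mul])
  have hort : ∀ m m', m ≠ m' → q m * q m' = 0 := fun m m' h => e.injective (by
    rw [map_mul, heq, heq, map_zero]
    funext k
    by_cases hk : k = m
    · subst hk; simp [Pi.single_eq_of_ne h]
    · simp [Pi.single_eq_of_ne hk])
  have hsum : ∑ m, q m = 1 := e.injective (by
    rw [map_sum, map_one]; simp only [heq]
    exact Finset.univ_sum_single (1 : ∀ m : MaximalSpectrum S, S ⧸ m.asIdeal))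
  have hscal : ∀ (x : S) m, ∃ z : ℂ, x * q m = z • q m := fun x m => by
    -- the residue field at `m` is a finite extension of `ℂ`, hence `ℂ` itself
    have : Algebra.IsIntegral ℂ (S ⧸ m.asIdeal) := Algebra.IsIntegral.of_finite _ _
    obtain ⟨z, hz⟩ := (IsAlgClosed.algebraMap_bijective_of_isIntegral
      (k := ℂ) (K := S ⧸ m.asIdeal)).2 (Ideal.Quotient.mk _ x)
    refine ⟨z, e.injective ?_⟩
    rw [Algebra.smul_def, map_mul, map_mul, heq]
    funext k
    by_cases hk : k = m
    · subst hk
      simp only [Pi.mul_apply, Pi.single_eq_same, mul_one]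
      exact hz.symm
    · simp [Pi.single_eq_of_ne hk]
  have hstar : ∀ m, star (q m) = q m := fun m => by
    by_cases h0 : q m = 0
    · rw [h0, star_zero]
    obtain ⟨z, hz⟩ := hscal (star (q m)) m
    have hne : star (q m) * q m ≠ 0 := fun h => h0 (Subtype.ext
      (hB.eq_zero_of_star_mul_self (by simpa using congrArg Subtype.val h)))
    have hz0 : z ≠ 0 := by rintro rfl; rw [zero_smul] at hz; exact hne hz
    have h1 : star z • star (q m) = z • q m := by
      rw [← hz, ← star_smul, ← hz, star_mul, star_star]
    have hz0' : star z ≠ 0 := star_ne_zero.2 hz0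
    have h2 : star (q m) = (z / star z) • q m := by
      rw [div_eq_inv_mul, mul_smul, ← h1, smul_smul, inv_mul_cancel₀ hz0', one_smul]
    have h3 : star (q m) * star (q m) = star (q m) := by rw [← star_mul, hqq]
    rw [h2, smul_mul_smul_comm, hqq] at h3
    have h4 := smul_left_injective ℂ h0 h3
    have h5 : z / star z = 1 := by
      have : z / star z ≠ 0 := div_ne_zero hz0 hz0'
      exact mul_left_cancel₀ this (by simpa using h4)
    rw [h2, h5, one_smul]
  refine ⟨MaximalSpectrum S, inferInstance, fun m => (q m : B), fun m => ?_, fun m => ?_,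
    fun m m' h => ?_, ?_, fun m => (q m).2, fun d hd m => ?_⟩
  · exact congrArg Subtype.val (hstar m)
  · exact congrArg Subtype.val (hqq m)
  · exact congrArg Subtype.val (hort m m' h)
  · simpa using congrArg Subtype.val hsum
  · have hdS : d ∈ S := ⟨0, d, hd, by simp⟩
    obtain ⟨z, hz⟩ := hscal ⟨d, hdS⟩ m
    have hz' : d * (q m : B) = z • (q m : B) := congrArg Subtype.val hz
    exact ⟨z, hz', by rw [unitization_comm hD (q m).2 hdS, hz']⟩

end Projections

/-! ### A separation lemma for bilinear maps -/

/-- Let `F` be a family of functionals on `V`.  If a tensor `∑ v r ⊗ m r` is mapped into `Q` by all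
`f ⊗ id` with `f ∈ F`, then it lies in `V' ⊗ P + V ⊗ Q`, where `V'` is the common kernel of `F` and
`P` contains all `m r`.  This is stated through a bilinear map `T` that sends `V' ⊗ P` and `V ⊗ Q`
into `R`. -/
theorem sum_mem_of_forall_functional {V M N ι : Type*} [AddCommGroup V] [Module ℂ V]
    [AddCommGroup M] [Module ℂ M] [AddCommGroup N] [Module ℂ N] [Fintype ι]
    {F : Set (V →ₗ[ℂ] ℂ)} {P Q : Submodule ℂ M} {R : Submodule ℂ N} (T : V →ₗ[ℂ] M →ₗ[ℂ] N)
    (v : ι → V) (m : ι → M) (hm : ∀ r, m r ∈ P)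
    (hF : ∀ f ∈ F, ∑ r, f (v r) • m r ∈ Q)
    (hP : ∀ x, (∀ f ∈ F, f x = 0) → ∀ y ∈ P, T x y ∈ R)
    (hQ : ∀ x, ∀ y ∈ Q, T x y ∈ R) : ∑ r, T (v r) (m r) ∈ R := by
  classical
  let P' : Submodule ℂ (M ⧸ Q) := P.map Q.mkQ
  let b := Module.Basis.ofVectorSpace ℂ P'
  have hlift : ∀ s, ∃ y ∈ P, Q.mkQ y = (b s : M ⧸ Q) := fun s => (b s).2
  choose e heP he using hlift
  let n : ι → P' := fun r => ⟨Q.mkQ (m r), m r, hm r, rfl⟩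
  let S : Finset _ := Finset.univ.biUnion fun r => (b.repr (n r)).support
  have hn : ∀ r, n r = ∑ s ∈ S, b.repr (n r) s • b s := fun r => by
    conv_lhs => rw [← b.linearCombination_repr (n r), Finsupp.linearCombination_apply]
    exact Finsupp.sum_of_support_subset _
      (Finset.subset_biUnion_of_mem (fun r => (b.repr (n r)).support) (Finset.mem_univ r)) _
      (by simp)
  have hq : ∀ r, m r - ∑ s ∈ S, b.repr (n r) s • e s ∈ Q := fun r => by
    refine (Submodule.Quotient.mk_eq_zero Q).1 ?_
    rw [← Submodule.mkQ_apply, map_sub, map_sum, sub_eq_zero]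
    have := congrArg (Submodule.subtype P') (hn r)
    rw [map_sum] at this
    simp only [map_smul, he]
    exact this
  have hker : ∀ s ∈ S, ∀ f ∈ F, f (∑ r, b.repr (n r) s • v r) = 0 := fun s _ f hf => by
    have h0 : ∑ r, f (v r) • n r = 0 := by
      apply Subtype.ext
      have := (Submodule.Quotient.mk_eq_zero Q).2 (hF f hf)
      rw [← Submodule.mkQ_apply, map_sum] at this
      rw [Submodule.coe_sum]
      simpa [n] using this
    have h1 := congrArg (fun x => b.repr x s) h0
    simp only [map_sum, map_smul, map_zero, Finsupp.coe_finsetSum, Finset.sum_apply,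
      Finsupp.smul_apply, Finsupp.zero_apply] at h1
    rw [map_sum, ← h1]
    exact Finset.sum_congr rfl fun r _ => by rw [map_smul, smul_eq_mul, smul_eq_mul, mul_comm]
  have hsum : ∑ r, T (v r) (m r) =
      ∑ s ∈ S, T (∑ r, b.repr (n r) s • v r) (e s) +
        ∑ r, T (v r) (m r - ∑ s ∈ S, b.repr (n r) s • e s) := by
    simp only [map_sum, map_sub, map_smul, LinearMap.sum_apply, LinearMap.smul_apply,
      Finset.sum_sub_distrib]
    rw [Finset.sum_comm]
    abel
  rw [hsum]
  exact add_mem (sum_mem fun s hs => hP _ (hker s hs) _ (heP s)) (sum_mem fun r _ => hQ _ _ (hq r))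

/-! ### Direct sums and tensor products of matrix representations -/

section Representations

variable {R : Type*} [Ring R] [Algebra ℂ R] [StarRing R]
variable {m n : Type} [Fintype m] [DecidableEq m] [Fintype n] [DecidableEq n]

/-- The direct sum of two matrix representations. -/
def blockRep (π : R →⋆ₐ[ℂ] Matrix m m ℂ) (ρ : R →⋆ₐ[ℂ] Matrix n n ℂ) :
    R →⋆ₐ[ℂ] Matrix (m ⊕ n) (m ⊕ n) ℂ where
  toFun x := fromBlocks (π x) 0 0 (ρ x)
  map_one' := by simp
  map_mul' x y := by simp [fromBlocks_multiply]
  map_zero' := by simp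
  map_add' x y := by simp [fromBlocks_add]
  commutes' z := by
    rw [AlgHomClass.commutes, AlgHomClass.commutes, Algebra.algebraMap_eq_smul_one,
      Algebra.algebraMap_eq_smul_one, Algebra.algebraMap_eq_smul_one, ← fromBlocks_one,
      fromBlocks_smul, smul_zero, smul_zero]
  map_star' x := by simp [map_star, star_eq_conjTranspose, fromBlocks_conjTranspose]

theorem blockRep_apply (π : R →⋆ₐ[ℂ] Matrix m m ℂ) (ρ : R →⋆ₐ[ℂ] Matrix n n ℂ) (x : R) :
    blockRep π ρ x = fromBlocks (π x) 0 0 (ρ x) := rfl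

variable (n) in
/-- The amplification `π ⊗ 1`. -/
def ampLeft (π : R →⋆ₐ[ℂ] Matrix m m ℂ) : R →⋆ₐ[ℂ] Matrix (m × n) (m × n) ℂ where
  toFun x := π x ⊗ₖ (1 : Matrix n n ℂ)
  map_one' := by simp
  map_mul' x y := by rw [← mul_kronecker_mul, map_mul, one_mul]
  map_zero' := by simp
  map_add' x y := by rw [map_add, add_kronecker]
  commutes' z := by
    rw [AlgHomClass.commutes, Algebra.algebraMap_eq_smul_one, Algebra.algebraMap_eq_smul_one,
      smul_kronecker, one_kronecker_one]
  map_star' x := by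
    rw [map_star, star_eq_conjTranspose, star_eq_conjTranspose, conjTranspose_kronecker,
      conjTranspose_one]

variable (m) in
/-- The amplification `1 ⊗ ρ`. -/
def ampRight (ρ : R →⋆ₐ[ℂ] Matrix n n ℂ) : R →⋆ₐ[ℂ] Matrix (m × n) (m × n) ℂ where
  toFun x := (1 : Matrix m m ℂ) ⊗ₖ ρ x
  map_one' := by simp
  map_mul' x y := by rw [← mul_kronecker_mul, map_mul, one_mul]
  map_zero' := by simp
  map_add' x y := by rw [map_add, kronecker_add]
  commutes' z := by
    rw [AlgHomClass.commutes, Algebra.algebraMap_eq_smul_one, Algebra.algebraMap_eq_smul_one,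
      kronecker_smul, one_kronecker_one]
  map_star' x := by
    rw [map_star, star_eq_conjTranspose, star_eq_conjTranspose, conjTranspose_kronecker,
      conjTranspose_one]

theorem ampLeft_apply (π : R →⋆ₐ[ℂ] Matrix m m ℂ) (x : R) :
    ampLeft n π x = π x ⊗ₖ (1 : Matrix n n ℂ) := rfl

theorem ampRight_apply (ρ : R →⋆ₐ[ℂ] Matrix n n ℂ) (x : R) :
    ampRight m ρ x = (1 : Matrix m m ℂ) ⊗ₖ ρ x := rfl

theorem commute_ampLeft_ampRight {R' : Type*} [Ring R'] [Algebra ℂ R'] [StarRing R']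
    (π : R →⋆ₐ[ℂ] Matrix m m ℂ) (ρ : R' →⋆ₐ[ℂ] Matrix n n ℂ) (x : R) (y : R') :
    Commute (ampLeft n π x) (ampRight m ρ y) := by
  rw [Commute, SemiconjBy, ampLeft_apply, ampRight_apply, ← mul_kronecker_mul,
    ← mul_kronecker_mul, one_mul, one_mul, mul_one, mul_one]

/-- The elementary tensor `v ⊗ w`. -/
def vecTensor (v : m → ℂ) (w : n → ℂ) : m × n → ℂ := fun a => v a.1 * w a.2

theorem ampLeft_mulVec (π : R →⋆ₐ[ℂ] Matrix m m ℂ) (x : R) (v : m → ℂ) (w : n → ℂ) :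
    ampLeft n π x *ᵥ vecTensor v w = vecTensor (π x *ᵥ v) w := by
  funext a
  simp only [ampLeft_apply, vecTensor, mulVec, dotProduct, kroneckerMap_apply, one_apply,
    Fintype.sum_prod_type, Finset.sum_mul]
  refine Finset.sum_congr rfl fun i _ => ?_
  rw [Finset.sum_eq_single a.2 (fun j _ hj => by simp [hj.symm]) (by simp)]
  simp [mul_assoc]

theorem ampRight_mulVec (ρ : R →⋆ₐ[ℂ] Matrix n n ℂ) (x : R) (v : m → ℂ) (w : n → ℂ) :
    ampRight m ρ x *ᵥ vecTensor v w = vecTensor v (ρ x *ᵥ w) := by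
  funext a
  simp only [ampRight_apply, vecTensor, mulVec, dotProduct, kroneckerMap_apply, one_apply,
    Fintype.sum_prod_type, Finset.mul_sum]
  rw [Finset.sum_eq_single a.1 (fun j _ hj => by simp [hj.symm]) (by simp)]
  refine Finset.sum_congr rfl fun i _ => ?_
  simp; ring

end Representations

theorem star_vecTensor_dotProduct {m n : Type} [Fintype m] [Fintype n] (v v' : m → ℂ)
    (w w' : n → ℂ) :
    star (vecTensor v w) ⬝ᵥ vecTensor v' w' = (star v ⬝ᵥ v') * (star w ⬝ᵥ w') := by
  simp only [vecTensor, dotProduct, Fintype.sum_prod_type, Finset.sum_mul_sum, Pi.star_apply,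
    star_mul']
  refine Finset.sum_congr rfl fun i _ => Finset.sum_congr rfl fun j _ => ?_
  ring

/-! ### Vector functionals -/

section VectorFunctionals

variable {R : Type*} [Ring R] [Algebra ℂ R] [StarRing R]

/-- The functionals `x ↦ ⟪α, π x β⟫` for finite-dimensional `*`-representations `π` and vectors
`α`, `β` in the ranges of `π e` and `π e'`; if `strict` holds, `α` and `β` have to be orthogonal. -/
def vectorFunctionals (strict : Prop) (e e' : R) : Set (R →ₗ[ℂ] ℂ) :=
  {f | ∃ (ι : Type) (_ : Fintype ι) (_ : DecidableEq ι) (π : R →⋆ₐ[ℂ] Matrix ι ι ℂ) (α β : ι → ℂ),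
    π e *ᵥ α = α ∧ π e' *ᵥ β = β ∧ (strict → star α ⬝ᵥ β = 0) ∧
      ∀ x, f x = star α ⬝ᵥ (π x *ᵥ β)}

theorem exists_vectorFunctional {strict : Prop} {e e' : R} {ι : Type} [Fintype ι] [DecidableEq ι]
    (π : R →⋆ₐ[ℂ] Matrix ι ι ℂ) (α β : ι → ℂ) (hα : π e *ᵥ α = α) (hβ : π e' *ᵥ β = β)
    (h : strict → star α ⬝ᵥ β = 0) :
    ∃ f ∈ vectorFunctionals strict e e', ∀ x, f x = star α ⬝ᵥ (π x *ᵥ β) :=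
  ⟨{ toFun := fun x => star α ⬝ᵥ (π x *ᵥ β)
     map_add' := fun x y => by rw [map_add, add_mulVec, dotProduct_add]
     map_smul' := fun z x => by rw [map_smul, smul_mulVec, dotProduct_smul]; rfl },
    ⟨ι, inferInstance, inferInstance, π, α, β, hα, hβ, h, fun _ => rfl⟩, fun _ => rfl⟩

theorem star_mulVec_dotProduct_of_star_eq {ι : Type} [Fintype ι] [DecidableEq ι]
    (π : R →⋆ₐ[ℂ] Matrix ι ι ℂ) {e : R} (he : star e = e) (α β : ι → ℂ) :
    star (π e *ᵥ α) ⬝ᵥ β = star α ⬝ᵥ (π e *ᵥ β) := by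
  rw [star_mulVec, ← star_eq_conjTranspose, ← map_star, he, dotProduct_mulVec]

/-- Vector functionals separate the corners `e R e'`; orthogonality of the vectors is no restriction
if `e` and `e'` are orthogonal. -/
theorem mul_mul_eq_zero_of_vectorFunctionals (hR : IsRFD R) {e e' : R} (he : star e = e)
    (hee : e * e = e) (he' : e' * e' = e') {strict : Prop} (hs : strict → e * e' = 0) {x : R}
    (hx : ∀ f ∈ vectorFunctionals strict e e', f x = 0) : e * x * e' = 0 := by
  refine hR.eq_zero_of_isNull fun n π => ?_
  ext i j
  obtain ⟨f, hf, hfx⟩ := exists_vectorFunctional (strict := strict) (e := e) (e' := e') π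
    (π e *ᵥ Pi.single i 1) (π e' *ᵥ Pi.single j 1) (by rw [mulVec_mulVec, ← map_mul, hee])
    (by rw [mulVec_mulVec, ← map_mul, he']) (fun h => by
      rw [star_mulVec_dotProduct_of_star_eq π he, mulVec_mulVec, ← map_mul, hs h]; simp)
  have h := hx f hf
  rw [hfx, star_mulVec_dotProduct_of_star_eq π he, mulVec_mulVec, mulVec_mulVec, ← map_mul,
    ← map_mul] at h
  simpa [← Pi.single_star] using h

/-- A compression `e x e` all of whose off-diagonal matrix coefficients vanish, in every
finite-dimensional `*`-representation, is a multiple of `e`. -/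
theorem exists_mul_mul_eq_smul_of_vectorFunctionals (hR : IsRFD R) {e : R} (he : star e = e)
    (hee : e * e = e) {x : R} (hx : ∀ f ∈ vectorFunctionals True e e, f x = 0) :
    ∃ z : ℂ, e * x * e = z • e := by
  -- every vector in the range of `π e` is an eigenvector of `π (e x e)`
  have key : ∀ {ι : Type} [Fintype ι] [DecidableEq ι] (π : R →⋆ₐ[ℂ] Matrix ι ι ℂ) (β : ι → ℂ),
      π e *ᵥ β = β → ∃ z : ℂ, π (e * x * e) *ᵥ β = z • β := by
    intro ι _ _ π β hβ
    by_cases h0 : β = 0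
    · exact ⟨0, by simp [h0]⟩
    have hne : star β ⬝ᵥ β ≠ 0 := fun h => h0 (dotProduct_star_self_eq_zero.1 h)
    set γ := π (e * x * e) *ᵥ β with hγ
    let z : ℂ := (star β ⬝ᵥ γ) / (star β ⬝ᵥ β)
    refine ⟨z, ?_⟩
    have heγ : π e *ᵥ γ = γ := by
      rw [hγ, mulVec_mulVec, ← map_mul, ← mul_assoc, ← mul_assoc, hee]
    let α := γ - z • β
    have heα : π e *ᵥ α = α := by
      simp only [α, mulVec_sub, mulVec_smul, heγ, hβ]
    have hβα : star β ⬝ᵥ α = 0 := by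
      simp only [α, z, dotProduct_sub, dotProduct_smul, smul_eq_mul, div_mul_cancel₀ _ hne,
        sub_self]
    have hαβ : star α ⬝ᵥ β = 0 := by
      rw [← star_star β, star_dotProduct_star, hβα, star_zero]
    obtain ⟨f, hf, hfx⟩ := exists_vectorFunctional (strict := True) π α β heα hβ fun _ => hαβ
    have h1 : star α ⬝ᵥ γ = 0 := by
      have := hx f hf
      rw [hfx] at this
      rw [hγ, map_mul, map_mul, ← mulVec_mulVec, hβ, ← mulVec_mulVec,
        ← star_mulVec_dotProduct_of_star_eq π he, heα, this]
    have h2 : star α ⬝ᵥ α = 0 := by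
      change star α ⬝ᵥ (γ - z • β) = 0
      rw [dotProduct_sub, dotProduct_smul, h1, hαβ, smul_zero, sub_zero]
    have h3 : α = 0 := dotProduct_star_self_eq_zero.1 h2
    exact sub_eq_zero.1 h3
  by_cases h0 : e = 0
  · exact ⟨0, by simp [h0]⟩
  obtain ⟨n₀, π₀, hπ₀⟩ : ∃ (n : ℕ) (π : R →⋆ₐ[ℂ] Matrix (Fin n) (Fin n) ℂ), π e ≠ 0 := by
    by_contra! h
    exact h0 (hR.eq_zero_of_isNull h)
  obtain ⟨β₀, hβ₀, hβ₀'⟩ : ∃ β₀, π₀ e *ᵥ β₀ = β₀ ∧ β₀ ≠ 0 := by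
    by_contra! h
    apply hπ₀
    ext i j
    have := congrFun (h (π₀ e *ᵥ Pi.single j 1) (by rw [mulVec_mulVec, ← map_mul, hee])) i
    simpa using this
  obtain ⟨z, hz⟩ := key π₀ β₀ hβ₀
  refine ⟨z, sub_eq_zero.1 (hR.eq_zero_of_isNull fun n π => ?_)⟩
  rw [map_sub, map_smul, sub_eq_zero]
  -- comparison with `π₀` inside the direct sum shows that the eigenvalue is always `z`
  have hall : ∀ β, π e *ᵥ β = β → π (e * x * e) *ᵥ β = z • β := by
    intro β hβ
    obtain ⟨w, hw⟩ := key (blockRep π₀ π) (Sum.elim β₀ β) (by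
      rw [blockRep_apply, fromBlocks_mulVec]
      simp [Function.comp_def, hβ₀, hβ])
    rw [blockRep_apply, fromBlocks_mulVec] at hw
    have hw1 : π₀ (e * x * e) *ᵥ β₀ = w • β₀ := by
      funext i; simpa [Function.comp_def] using congrFun hw (Sum.inl i)
    have hw2 : π (e * x * e) *ᵥ β = w • β := by
      funext i; simpa [Function.comp_def] using congrFun hw (Sum.inr i)
    rw [hz] at hw1
    rw [hw2, smul_left_injective ℂ hβ₀' hw1]
  ext i j
  have h1 := hall (π e *ᵥ Pi.single j 1) (by rw [mulVec_mulVec, ← map_mul, hee])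
  rw [mulVec_mulVec, ← map_mul, mul_assoc, hee, ← smul_mulVec] at h1
  simpa using congrFun h1 i

end VectorFunctionals

/-! ### Words in two algebras -/

section Words

variable {B C M : Type*} [Ring B] [Algebra ℂ B] [Ring C] [Algebra ℂ C] [Ring M] [Algebra ℂ M]

/-- The homomorphism from the free algebra on letters from `C` and `B`, linear in each letter, that
extends two linear maps. -/
noncomputable def wordHom (f : C →ₗ[ℂ] M) (g : B →ₗ[ℂ] M) : TensorAlgebra ℂ (C × B) →ₐ[ℂ] M :=
  TensorAlgebra.lift ℂ (f.coprod g)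

theorem wordHom_inl (f : C →ₗ[ℂ] M) (g : B →ₗ[ℂ] M) (c : C) :
    wordHom f g (TensorAlgebra.ι ℂ (c, 0)) = f c := by
  simp [wordHom]

theorem wordHom_inr (f : C →ₗ[ℂ] M) (g : B →ₗ[ℂ] M) (b : B) :
    wordHom f g (TensorAlgebra.ι ℂ (0, b)) = g b := by
  simp [wordHom]

theorem wordHom_ι (f : C →ₗ[ℂ] M) (g : B →ₗ[ℂ] M) (x : C × B) :
    wordHom f g (TensorAlgebra.ι ℂ x) = f x.1 + g x.2 := by
  simp [wordHom]

variable (B C) in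
/-- The span of the words `b₀ c₁ b₁ ⋯ cₖ bₖ`. -/
noncomputable def wordSpace : ℕ → Submodule ℂ (TensorAlgebra ℂ (C × B))
  | 0 => LinearMap.range (TensorAlgebra.ι ℂ ∘ₗ LinearMap.inr ℂ C B)
  | k + 1 => Submodule.span ℂ {x | ∃ (b : B) (c : C), ∃ y ∈ wordSpace k,
      x = TensorAlgebra.ι ℂ (0, b) * (TensorAlgebra.ι ℂ (c, 0) * y)}

theorem mul_mem_wordSpace_succ (b : B) (c : C) {k : ℕ} {y : TensorAlgebra ℂ (C × B)}
    (hy : y ∈ wordSpace B C k) :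
    TensorAlgebra.ι ℂ (0, b) * (TensorAlgebra.ι ℂ (c, 0) * y) ∈ wordSpace B C (k + 1) :=
  Submodule.subset_span ⟨b, c, y, hy, rfl⟩

theorem exists_sum_of_mem_wordSpace_succ {k : ℕ} {z : TensorAlgebra ℂ (C × B)}
    (hz : z ∈ wordSpace B C (k + 1)) :
    ∃ (n : ℕ) (b : Fin n → B) (c : Fin n → C) (y : Fin n → TensorAlgebra ℂ (C × B)),
      (∀ r, y r ∈ wordSpace B C k) ∧
        z = ∑ r, TensorAlgebra.ι ℂ (0, b r) * (TensorAlgebra.ι ℂ (c r, 0) * y r) := by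
  obtain ⟨n, t, g, rfl⟩ := Submodule.mem_span_set'.1 hz
  choose b c y hy hg using fun r => (g r).2
  refine ⟨n, b, c, fun r => t r • y r, fun r => Submodule.smul_mem _ _ (hy r), ?_⟩
  exact Finset.sum_congr rfl fun r _ => by rw [hg r, mul_smul_comm, mul_smul_comm]

/-- The linear map `c ↦ g σ(c) g'`. -/
def sandwich (σ : C →ₐ[ℂ] M) (g g' : M) : C →ₗ[ℂ] M :=
  LinearMap.mulRight ℂ g' ∘ₗ LinearMap.mulLeft ℂ g ∘ₗ σ.toLinearMap

theorem sandwich_apply (σ : C →ₐ[ℂ] M) (g g' : M) (c : C) :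
    sandwich σ g g' c = g * σ c * g' := rfl

/-- Conjugation of a homomorphism by an invertible element. -/
def conjHom (σ : C →ₐ[ℂ] M) (g g' : M) (h : g * g' = 1) (h' : g' * g = 1) : C →ₐ[ℂ] M :=
  AlgHom.ofLinearMap (sandwich σ g g') (by simp [sandwich_apply, h]) fun x y => by
    simp only [sandwich_apply, map_mul]
    calc g * (σ x * σ y) * g' = g * σ x * 1 * σ y * g' := by noncomm_ring
      _ = g * σ x * g' * (g * σ y * g') := by rw [← h']; noncomm_ring

theorem conjHom_apply (σ : C →ₐ[ℂ] M) (g g' : M) (h : g * g' = 1) (h' : g' * g = 1) (c : C) :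
    conjHom σ g g' h h' c = g * σ c * g' := rfl

end Words

/-! ### Representations of the quotient by commutators -/

section Lift

variable {B C : Type*} [Ring B] [Algebra ℂ B] [StarRing B] [Ring C] [Algebra ℂ C]
variable {D : NonUnitalStarSubalgebra ℂ B}
variable {M : Type*} [Ring M] [Algebra ℂ M]

namespace FreeProdModComm

variable (C D) in
/-- The canonical homomorphism from the first factor. -/
noncomputable def inl : C →ₐ[ℂ] FreeProdModComm C D := (mk C D).comp (FreeProd.inl C B)

variable (C D) in
/-- The canonical homomorphism from the second factor. -/
noncomputable def inr : B →ₐ[ℂ] FreeProdModComm C D := (mk C D).comp (FreeProd.inr C B)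

theorem inl_mul_inr (c : C) {d : B} (hd : d ∈ D) :
    inl C D c * inr C D d = inr C D d * inl C D c := by
  have h := RingQuot.mkAlgHom_rel ℂ (CommutatorRel.comm (A := C) (D := D) c d hd)
  change mk C D _ = mk C D _ at h
  rwa [map_mul, map_mul] at h

theorem induction {P : FreeProdModComm C D → Prop} (x : FreeProdModComm C D)
    (hl : ∀ c, P (inl C D c)) (hr : ∀ b, P (inr C D b))
    (hadd : ∀ x y, P x → P y → P (x + y)) (hmul : ∀ x y, P x → P y → P (x * y)) : P x := by
  obtain ⟨x, rfl⟩ := RingQuot.mkAlgHom_surjective ℂ (CommutatorRel (A := C) D) x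
  change P (mk C D x)
  induction x using FreeProd.induction with
  | hl a => exact hl a
  | hr b => exact hr b
  | hadd x y hx hy => rw [map_add]; exact hadd _ _ hx hy
  | hmul x y hx hy => rw [map_mul]; exact hmul _ _ hx hy

/-- The homomorphism given by homomorphisms of `C` and `B` with commuting images of `C` and `D`. -/
noncomputable def lift (σ : C →ₐ[ℂ] M) (ρ : B →ₐ[ℂ] M)
    (h : ∀ c, ∀ d ∈ D, σ c * ρ d = ρ d * σ c) : FreeProdModComm C D →ₐ[ℂ] M :=
  RingQuot.liftAlgHom ℂ ⟨FreeProd.lift σ ρ, by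
    rintro _ _ (⟨c, d, hd⟩ | ⟨c, d, hd⟩) <;> simp [h c d hd]⟩

theorem lift_inl (σ : C →ₐ[ℂ] M) (ρ : B →ₐ[ℂ] M) (h : ∀ c, ∀ d ∈ D, σ c * ρ d = ρ d * σ c)
    (c : C) : lift σ ρ h (inl C D c) = σ c := by
  change RingQuot.liftAlgHom ℂ _ (RingQuot.mkAlgHom ℂ _ _) = _
  simp

theorem lift_inr (σ : C →ₐ[ℂ] M) (ρ : B →ₐ[ℂ] M) (h : ∀ c, ∀ d ∈ D, σ c * ρ d = ρ d * σ c)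
    (b : B) : lift σ ρ h (inr C D b) = ρ b := by
  change RingQuot.liftAlgHom ℂ _ (RingQuot.mkAlgHom ℂ _ _) = _
  simp

variable (C D) in
/-- The element of the quotient represented by a combination of words. -/
noncomputable def ofWord : TensorAlgebra ℂ (C × B) →ₐ[ℂ] FreeProdModComm C D :=
  wordHom (inl C D).toLinearMap (inr C D).toLinearMap

theorem lift_ofWord (σ : C →ₐ[ℂ] M) (ρ : B →ₐ[ℂ] M) (h : ∀ c, ∀ d ∈ D, σ c * ρ d = ρ d * σ c)
    (z : TensorAlgebra ℂ (C × B)) :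
    lift σ ρ h (ofWord C D z) = wordHom σ.toLinearMap ρ.toLinearMap z := by
  refine congrArg (fun f => f z) (?_ : (lift σ ρ h).comp (ofWord C D) = _)
  ext x
  · simp [ofWord, wordHom, lift_inl]
  · simp [ofWord, wordHom, lift_inr]

variable (C D) in
/-- The image in the quotient of the words `b₀ c₁ b₁ ⋯ cₖ bₖ`. -/
noncomputable def wordImage (k : ℕ) : Submodule ℂ (FreeProdModComm C D) :=
  (wordSpace B C k).map (ofWord C D).toLinearMap

theorem ofWord_mem_wordImage {k : ℕ} {z : TensorAlgebra ℂ (C × B)} (hz : z ∈ wordSpace B C k) :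
    ofWord C D z ∈ wordImage C D k :=
  Submodule.mem_map_of_mem hz

theorem ofWord_mul_mul (b : B) (c : C) (y : TensorAlgebra ℂ (C × B)) :
    ofWord C D (TensorAlgebra.ι ℂ (0, b) * (TensorAlgebra.ι ℂ (c, 0) * y)) =
      inr C D b * (inl C D c * ofWord C D y) := by
  rw [map_mul, map_mul, ofWord, wordHom_inl, wordHom_inr]; rfl

theorem ofWord_inr (b : B) :
    ofWord C D (TensorAlgebra.ι ℂ (0, b)) = inr C D b := by
  rw [ofWord, wordHom_inr]; rfl

theorem inr_mul_inl_mul_mem (b : B) (c : C) {k : ℕ} {x : FreeProdModComm C D}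
    (hx : x ∈ wordImage C D k) : inr C D b * (inl C D c * x) ∈ wordImage C D (k + 1) := by
  obtain ⟨z, hz, rfl⟩ := hx
  rw [AlgHom.toLinearMap_apply, ← ofWord_mul_mul]
  exact ofWord_mem_wordImage (mul_mem_wordSpace_succ b c hz)

theorem inr_mem_wordImage (b : B) : inr C D b ∈ wordImage C D 0 := by
  rw [← ofWord_inr]
  exact ofWord_mem_wordImage ⟨b, rfl⟩

theorem wordImage_succ_induction {k : ℕ} (N : Submodule ℂ (FreeProdModComm C D))
    (h : ∀ b c, ∀ y ∈ wordImage C D k, inr C D b * (inl C D c * y) ∈ N) :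
    wordImage C D (k + 1) ≤ N := by
  rintro _ ⟨z, hz, rfl⟩
  obtain ⟨n, b, c, y, hy, rfl⟩ := exists_sum_of_mem_wordSpace_succ hz
  rw [map_sum]
  refine sum_mem fun r _ => ?_
  rw [AlgHom.toLinearMap_apply, ofWord_mul_mul]
  exact h _ _ _ (ofWord_mem_wordImage (hy r))

theorem inr_mul_mem (b : B) {k : ℕ} {x : FreeProdModComm C D} (hx : x ∈ wordImage C D k) :
    inr C D b * x ∈ wordImage C D k := by
  cases k with
  | zero =>
    obtain ⟨_, ⟨b', rfl⟩, rfl⟩ := hx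
    have : (ofWord C D).toLinearMap ((TensorAlgebra.ι ℂ ∘ₗ LinearMap.inr ℂ C B) b') =
      inr C D b' := ofWord_inr b'
    rw [this, ← map_mul]
    exact inr_mem_wordImage _
  | succ k =>
    refine wordImage_succ_induction
      ((wordImage C D (k + 1)).comap (LinearMap.mulLeft ℂ (inr C D b))) (fun b' c y hy => ?_) hx
    rw [Submodule.mem_comap, LinearMap.mulLeft_apply, ← mul_assoc, ← map_mul]
    exact inr_mul_inl_mul_mem _ _ hy

theorem inl_mul_mem (c : C) {k : ℕ} {x : FreeProdModComm C D} (hx : x ∈ wordImage C D k) :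
    inl C D c * x ∈ wordImage C D (k + 1) := by
  have := inr_mul_inl_mul_mem 1 c hx
  rwa [map_one, one_mul] at this

theorem wordImage_mono : Monotone (wordImage C D) :=
  monotone_nat_of_le_succ fun k x hx => by
    have := inl_mul_mem 1 hx
    rwa [map_one, one_mul] at this

theorem exists_mem_wordImage (x : FreeProdModComm C D) : ∃ k, x ∈ wordImage C D k := by
  suffices h : ∀ k, ∀ y ∈ wordImage C D k, ∃ l, x * y ∈ wordImage C D l by
    have h1 := h 0 (inr C D 1) (inr_mem_wordImage 1)
    rwa [map_one, mul_one] at h1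
  induction x using FreeProdModComm.induction with
  | hl c => exact fun k y hy => ⟨_, inl_mul_mem c hy⟩
  | hr b => exact fun k y hy => ⟨_, inr_mul_mem b hy⟩
  | hadd x y hx hy =>
    intro k w hw
    obtain ⟨l, hl⟩ := hx k w hw
    obtain ⟨m, hm⟩ := hy k w hw
    refine ⟨max l m, ?_⟩
    rw [add_mul]
    exact add_mem (wordImage_mono (le_max_left _ _) hl) (wordImage_mono (le_max_right _ _) hm)
  | hmul x y hx hy =>
    intro k w hw
    obtain ⟨l, hl⟩ := hy k w hw
    obtain ⟨m, hm⟩ := hx l _ hl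
    exact ⟨m, by rwa [mul_assoc]⟩

variable [StarModule ℂ B] [StarRing C] [StarModule ℂ C]

theorem star_inl (c : C) : star (inl C D c) = inl C D (star c) :=
  (star_mk C D _).trans (congrArg (mk C D) (FreeProd.star_inl c))

theorem star_inr (b : B) : star (inr C D b) = inr C D (star b) :=
  (star_mk C D _).trans (congrArg (mk C D) (FreeProd.star_inr b))

/-- The `*`-homomorphism given by `*`-homomorphisms of `C` and `B` with commuting images of `C`
and `D`. -/
noncomputable def liftStar [StarRing M] (σ : C →ₐ[ℂ] M) (ρ : B →ₐ[ℂ] M)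
    (h : ∀ c, ∀ d ∈ D, σ c * ρ d = ρ d * σ c) (hσ : ∀ c, σ (star c) = star (σ c))
    (hρ : ∀ b, ρ (star b) = star (ρ b)) : FreeProdModComm C D →⋆ₐ[ℂ] M where
  __ := lift σ ρ h
  map_star' x := by
    change lift σ ρ h (star x) = star (lift σ ρ h x)
    induction x using FreeProdModComm.induction with
    | hl c => rw [star_inl, lift_inl, lift_inl, hσ]
    | hr b => rw [star_inr, lift_inr, lift_inr, hρ]
    | hadd x y hx hy => rw [star_add, map_add, hx, hy, map_add, star_add]
    | hmul x y hx hy => rw [star_mul, map_mul, hx, hy, map_mul, star_mul]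

end FreeProdModComm

end Lift

/-! ### From unitary to arbitrary conjugations -/

section Analytic

open Filter Topology NormedSpace

/-- An entire function that vanishes on the real line is zero. -/
theorem eq_zero_of_forall_real {E : Type*} [NormedAddCommGroup E] [NormedSpace ℂ E]
    [CompleteSpace E] {f : ℂ → E} (hf : Differentiable ℂ f)
    (h : ∀ a : ℝ, f a = 0) (z : ℂ) : f z = 0 := by
  have hfa : AnalyticOnNhd ℂ f Set.univ := hf.differentiableOn.analyticOnNhd isOpen_univ
  have ht : Tendsto (fun a : ℝ => (a : ℂ)) (𝓝[≠] 0) (𝓝[≠] 0) := by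
    refine tendsto_nhdsWithin_iff.2 ⟨?_, ?_⟩
    · exact (Complex.continuous_ofReal.tendsto' 0 0 (by simp)).mono_left nhdsWithin_le_nhds
    · filter_upwards [self_mem_nhdsWithin] with a ha
      simpa using ha
  have hfr : ∃ᶠ z in 𝓝[≠] (0 : ℂ), f z = (0 : ℂ → E) z :=
    ht.frequently (Eventually.frequently (Eventually.of_forall h))
  exact congrFun (hfa.eq_of_frequently_eq (fun _ _ => analyticAt_const) hfr) z

variable {B C M : Type*} [Ring B] [Algebra ℂ B] [Ring C] [Algebra ℂ C]
variable [NormedRing M] [NormedAlgebra ℂ M]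

theorem differentiable_wordHom_sandwich (ρ : B →ₗ[ℂ] M) (σ : C →ₐ[ℂ] M) {g g' : ℂ → M}
    (hg : Differentiable ℂ g) (hg' : Differentiable ℂ g') (z : TensorAlgebra ℂ (C × B)) :
    Differentiable ℂ fun a => wordHom (sandwich σ (g a) (g' a)) ρ z := by
  induction z using TensorAlgebra.induction with
  | algebraMap r => simp only [AlgHom.commutes]; exact differentiable_const _
  | ι x =>
    simp only [wordHom_ι, sandwich_apply]
    exact ((hg.mul (differentiable_const _)).mul hg').add (differentiable_const _)
  | mul x y hx hy => simp only [map_mul]; exact hx.mul hy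
  | add x y hx hy => simp only [map_add]; exact hx.add hy

/-- For a square-zero `Y`, conjugation by `1 + t Y` is quadratic in `t` with leading coefficient
`c ↦ -Y c Y`.  The leading coefficient of a combination of words with `k` letters from `C` is
obtained by this replacement in every letter; it vanishes if the conjugates vanish for all `t`. -/
theorem wordHom_leading_eq_zero (ρ : B →ₗ[ℂ] M) (σ : C →ₐ[ℂ] M) {Y : M} {k : ℕ}
    {z : TensorAlgebra ℂ (C × B)} (hzk : z ∈ wordSpace B C k)
    (hz : ∀ t : ℂ, wordHom (sandwich σ (1 + t • Y) (1 - t • Y)) ρ z = 0) :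
    wordHom (sandwich σ Y (-Y)) ρ z = 0 := by
  -- rescaling by `ε = t⁻¹` moves the limit `t → ∞` to the limit `ε → 0` of polynomials in `ε`
  have hscale : ∀ ε : ℂ, ε ≠ 0 → wordHom (sandwich σ (ε • 1 + Y) (ε • 1 - Y)) ρ z =
      (ε ^ 2) ^ k • wordHom (sandwich σ (1 + ε⁻¹ • Y) (1 - ε⁻¹ • Y)) ρ z := by
    intro ε hε
    clear hz
    have hl : ∀ c, sandwich σ (ε • 1 + Y) (ε • 1 - Y) c =
        ε ^ 2 • sandwich σ (1 + ε⁻¹ • Y) (1 - ε⁻¹ • Y) c := fun c => by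
      have e1 : ε • 1 + Y = ε • (1 + ε⁻¹ • Y) := by
        rw [smul_add, smul_smul, mul_inv_cancel₀ hε, one_smul]
      have e2 : ε • 1 - Y = ε • (1 - ε⁻¹ • Y) := by
        rw [smul_sub, smul_smul, mul_inv_cancel₀ hε, one_smul]
      rw [sandwich_apply, sandwich_apply, e1, e2, smul_mul_assoc, smul_mul_assoc, mul_smul_comm,
        smul_smul, pow_two]
    induction k generalizing z with
    | zero =>
      obtain ⟨b, rfl⟩ := hzk
      simp only [LinearMap.comp_apply, LinearMap.inr_apply, wordHom_inr, pow_zero, one_smul]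
    | succ k ih =>
      obtain ⟨n, b, c, y, hy, rfl⟩ := exists_sum_of_mem_wordSpace_succ hzk
      rw [map_sum, map_sum, Finset.smul_sum]
      refine Finset.sum_congr rfl fun r _ => ?_
      rw [map_mul, map_mul, map_mul, map_mul, wordHom_inr, wordHom_inr, wordHom_inl, wordHom_inl,
        ih (hy r), hl, smul_mul_smul_comm, mul_smul_comm, pow_succ' (ε ^ 2) k]
  have hcont : Continuous fun ε : ℂ => wordHom (sandwich σ (ε • 1 + Y) (ε • 1 - Y)) ρ z :=
    (differentiable_wordHom_sandwich ρ σ (by fun_prop) (by fun_prop) z).continuous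
  have h0 : ∀ ε ∈ ({0}ᶜ : Set ℂ), wordHom (sandwich σ (ε • 1 + Y) (ε • 1 - Y)) ρ z = 0 :=
    fun ε hε => by rw [hscale ε hε, hz, smul_zero]
  have h := congrFun (hcont.ext_on (dense_compl_singleton (0 : ℂ)) continuous_const h0) 0
  simpa using h

theorem exp_eq_one_add {Y : M} (hY : Y * Y = 0) : exp Y = 1 + Y := by
  rw [exp_eq_tsum ℂ]
  beta_reduce
  rw [tsum_eq_sum (s := Finset.range 2)]
  · simp [Finset.sum_range_succ]
  · intro n hn
    obtain ⟨m, rfl⟩ := Nat.exists_eq_add_of_le (not_lt.1 fun h => hn (Finset.mem_range.2 h))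
    rw [pow_add, pow_two, hY, zero_mul, smul_zero]

variable [CompleteSpace M]

/-- The unitarian trick: a word expression in `ρ b` and `g σ(c) g⁻¹` that vanishes for all unitaries
`g` in the commutant of the self-adjoint set `S` vanishes for all exponentials `g` of elements of the
commutant.  Indeed it is an entire function of `(s, t)` for `g = exp (s V₁ + t V₂)` with `V₁`, `V₂`
skew-adjoint, and it vanishes for real `s`, `t`. -/
theorem wordHom_exp_eq_zero [StarRing M] [StarModule ℂ M] [ContinuousStar M]
    {S : Set M} (hS : ∀ d ∈ S, star d ∈ S) (ρ : B →ₗ[ℂ] M) (σ : C →ₐ[ℂ] M)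
    {z : TensorAlgebra ℂ (C × B)}
    (hz : ∀ u : M, u * star u = 1 → star u * u = 1 → (∀ d ∈ S, Commute d u) →
      wordHom (sandwich σ u (star u)) ρ z = 0)
    {W : M} (hW : ∀ d ∈ S, Commute d W) :
    wordHom (sandwich σ (exp W) (exp (-W))) ρ z = 0 := by
  let _ : NormedAlgebra ℚ M := NormedAlgebra.restrictScalars ℚ ℂ M
  have hexp : Differentiable ℂ (exp : M → M) := fun x =>
    (exp_analytic (𝕂 := ℂ) x).differentiableAt
  have hWs : ∀ d ∈ S, Commute d (star W) := fun d hd => by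
    have := (hW (star d) (hS d hd)).star_star
    rwa [star_star] at this
  set V₁ := W - star W with hV₁
  set V₂ := Complex.I • (W + star W) with hV₂
  have hs₁ : star V₁ = -V₁ := by rw [hV₁, star_sub, star_star, neg_sub]
  have hs₂ : star V₂ = -V₂ := by
    rw [hV₂, star_smul, star_add, star_star, Complex.star_def, Complex.conj_I, neg_smul, add_comm]
  have hc : ∀ s t : ℂ, ∀ d ∈ S, Commute d (s • V₁ + t • V₂) := fun s t d hd =>
    (((hW d hd).sub_right (hWs d hd)).smul_right s).add_right
      ((((hW d hd).add_right (hWs d hd)).smul_right _).smul_right t)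
  have hreal : ∀ s t : ℝ, wordHom (sandwich σ (exp ((s : ℂ) • V₁ + (t : ℂ) • V₂))
      (exp (-((s : ℂ) • V₁ + (t : ℂ) • V₂)))) ρ z = 0 := by
    intro s t
    set X := (s : ℂ) • V₁ + (t : ℂ) • V₂ with hX
    have hXs : star X = -X := by
      rw [hX, star_add, star_smul, star_smul, hs₁, hs₂, Complex.star_def, Complex.conj_ofReal,
        Complex.conj_ofReal, smul_neg, smul_neg, neg_add]
    have hu : star (exp X) = exp (-X) := by rw [star_exp, hXs]
    rw [← hu]
    refine hz _ ?_ ?_ fun d hd => (hc s t d hd).exp_right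
    · rw [hu, ← exp_add_of_commute (Commute.neg_right (Commute.refl X)), add_neg_cancel, exp_zero]
    · rw [hu, ← exp_add_of_commute (Commute.neg_left (Commute.refl X)), neg_add_cancel, exp_zero]
  have h1 : ∀ (s : ℂ) (t : ℝ), wordHom (sandwich σ (exp (s • V₁ + (t : ℂ) • V₂))
      (exp (-(s • V₁ + (t : ℂ) • V₂)))) ρ z = 0 := by
    intro s t
    refine eq_zero_of_forall_real (f := fun s : ℂ => wordHom (sandwich σ (exp (s • V₁ + (t : ℂ) • V₂))
      (exp (-(s • V₁ + (t : ℂ) • V₂)))) ρ z) ?_ (fun s => hreal s t) s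
    have : Differentiable ℂ fun s : ℂ => s • V₁ + (t : ℂ) • V₂ := by fun_prop
    exact differentiable_wordHom_sandwich ρ σ (hexp.comp this) (hexp.comp this.neg) z
  have h2 : ∀ s t : ℂ, wordHom (sandwich σ (exp (s • V₁ + t • V₂))
      (exp (-(s • V₁ + t • V₂)))) ρ z = 0 := by
    intro s t
    refine eq_zero_of_forall_real (f := fun t : ℂ => wordHom (sandwich σ (exp (s • V₁ + t • V₂))
      (exp (-(s • V₁ + t • V₂)))) ρ z) ?_ (fun t => h1 s t) t
    have : Differentiable ℂ fun t : ℂ => s • V₁ + t • V₂ := by fun_prop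
    exact differentiable_wordHom_sandwich ρ σ (hexp.comp this) (hexp.comp this.neg) z
  have hWV : W = (1 / 2 : ℂ) • V₁ + (-(Complex.I / 2)) • V₂ := by
    rw [hV₁, hV₂, smul_smul]
    have : -(Complex.I / 2) * Complex.I = 1 / 2 := by
      linear_combination (-1 / 2 : ℂ) * Complex.I_mul_I
    rw [this, ← smul_add, sub_add_add_cancel, ← two_smul ℂ W, smul_smul]
    norm_num
  rw [hWV]
  exact h2 _ _

end Analytic

/-! ### Linked representations -/

section Linked

variable {B C : Type*} [Ring B] [Algebra ℂ B] [StarRing B] [Ring C] [Algebra ℂ C] [StarRing C]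
variable {D : NonUnitalStarSubalgebra ℂ B}

/-- Representations `ρ` of `B` and `σ` of `C` on the same space, with commuting images of `D` and
`C`, together with a square-zero matrix `Y` in the commutant of `ρ(D)`. -/
structure IsLinked (D : NonUnitalStarSubalgebra ℂ B) {ι : Type} [Fintype ι] [DecidableEq ι]
    (ρ : B →⋆ₐ[ℂ] Matrix ι ι ℂ) (σ : C →⋆ₐ[ℂ] Matrix ι ι ℂ) (Y : Matrix ι ι ℂ) : Prop where
  comm : ∀ d ∈ D, ∀ c, Commute (ρ d) (σ c)
  sq : Y * Y = 0
  link : ∀ d ∈ D, Commute (ρ d) Y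

/-- The value of a word after the replacements of `b` by `ρ b` and of `c` by `-Y σ(c) Y`. -/
noncomputable def leadingHom {ι : Type} [Fintype ι] [DecidableEq ι]
    (ρ : B →⋆ₐ[ℂ] Matrix ι ι ℂ) (σ : C →⋆ₐ[ℂ] Matrix ι ι ℂ) (Y : Matrix ι ι ℂ) :
    TensorAlgebra ℂ (C × B) →ₐ[ℂ] Matrix ι ι ℂ :=
  wordHom (sandwich (σ : C →ₐ[ℂ] Matrix ι ι ℂ) Y (-Y)) (ρ : B →ₐ[ℂ] Matrix ι ι ℂ).toLinearMap

section

variable {ι : Type} [Fintype ι] [DecidableEq ι] (ρ : B →⋆ₐ[ℂ] Matrix ι ι ℂ)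
  (σ : C →⋆ₐ[ℂ] Matrix ι ι ℂ) (Y : Matrix ι ι ℂ)

theorem leadingHom_inl (c : C) :
    leadingHom ρ σ Y (TensorAlgebra.ι ℂ (c, 0)) = Y * σ c * (-Y) := by
  rw [leadingHom, wordHom_inl]; rfl

theorem leadingHom_inr (b : B) : leadingHom ρ σ Y (TensorAlgebra.ι ℂ (0, b)) = ρ b := by
  rw [leadingHom, wordHom_inr]; rfl

end

open scoped Matrix.Norms.L2Operator in
/-- If a combination of words with `k` letters from `C` is null in `C * B / [C, D]`, then so is its
leading coefficient for every linked representation. -/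
theorem IsLinked.leadingHom_eq_zero [StarModule ℂ B] [StarModule ℂ C] {ι : Type} [Fintype ι]
    [DecidableEq ι] {ρ : B →⋆ₐ[ℂ] Matrix ι ι ℂ} {σ : C →⋆ₐ[ℂ] Matrix ι ι ℂ} {Y : Matrix ι ι ℂ}
    (h : IsLinked D ρ σ Y) {k : ℕ} {z : TensorAlgebra ℂ (C × B)} (hzk : z ∈ wordSpace B C k)
    (hz : IsNull (FreeProdModComm.ofWord C D z)) : leadingHom ρ σ Y z = 0 := by
  refine wordHom_leading_eq_zero _ _ hzk fun t => ?_
  have hsq : (t • Y) * (t • Y) = 0 := by rw [smul_mul_smul_comm, h.sq, smul_zero]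
  have hsq' : (-(t • Y)) * (-(t • Y)) = 0 := by rw [neg_mul_neg, hsq]
  rw [sub_eq_add_neg, ← exp_eq_one_add hsq, ← exp_eq_one_add hsq']
  refine wordHom_exp_eq_zero (S := ρ '' D) ?_ _ _ (fun u hu hu' hc => ?_) ?_
  · rintro _ ⟨d, hd, rfl⟩
    exact ⟨star d, star_mem hd, map_star ρ d⟩
  · have hcomm : ∀ c, ∀ d ∈ D,
        conjHom (σ : C →ₐ[ℂ] Matrix ι ι ℂ) u (star u) hu hu' c * (ρ : B →ₐ[ℂ] Matrix ι ι ℂ) d =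
          (ρ : B →ₐ[ℂ] Matrix ι ι ℂ) d * conjHom (σ : C →ₐ[ℂ] Matrix ι ι ℂ) u (star u) hu hu' c := by
      intro c d hd
      have h1 : Commute (ρ d) u := hc _ ⟨d, hd, rfl⟩
      have h2 : Commute (ρ d) (star u) := by
        have := (hc _ ⟨star d, star_mem hd, rfl⟩ : Commute (ρ (star d)) u).star_star
        rwa [map_star, star_star] at this
      exact ((h1.mul_right (h.comm d hd c)).mul_right h2).eq.symm
    have h1 := hz.map_eq_zero (FreeProdModComm.liftStar
      (conjHom (σ : C →ₐ[ℂ] Matrix ι ι ℂ) u (star u) hu hu') (ρ : B →ₐ[ℂ] Matrix ι ι ℂ) hcomm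
      (fun c => by
        rw [conjHom_apply, conjHom_apply, star_mul, star_mul, star_star, mul_assoc]
        exact congrArg (fun x => u * (x * star u)) (map_star σ c)) (map_star ρ))
    exact (FreeProdModComm.lift_ofWord _ _ hcomm z).symm.trans h1
  · rintro _ ⟨d, hd, rfl⟩
    exact (h.link d hd).smul_right t

/-- The matrix `Y` with an additional rank-one link `|u⟩⟨ξ|` to a new orthogonal summand. -/
def addLink {κ ι : Type} (u : κ → ℂ) (ξ : ι → ℂ) (Y : Matrix ι ι ℂ) : Matrix (κ ⊕ ι) (κ ⊕ ι) ℂ :=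
  fromBlocks 0 (vecMulVec u (star ξ)) 0 Y

section AddLink

variable {κ ι : Type} [Fintype κ] [DecidableEq κ] [Fintype ι] [DecidableEq ι]
variable {ρ : B →⋆ₐ[ℂ] Matrix ι ι ℂ} {σ : C →⋆ₐ[ℂ] Matrix ι ι ℂ} {Y : Matrix ι ι ℂ}
variable {ρ' : B →⋆ₐ[ℂ] Matrix κ κ ℂ} {σ' : C →⋆ₐ[ℂ] Matrix κ κ ℂ}

/-- The new matrix is again square-zero because `⟨ξ| Y = 0`, and it commutes with `D` because `D`
acts on `u` and on `ξ` by the same scalars. -/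
theorem IsLinked.addLink (h : IsLinked D ρ σ Y) (h' : ∀ d ∈ D, ∀ c, Commute (ρ' d) (σ' c))
    {u : κ → ℂ} {ξ : ι → ℂ} (hξ : star ξ ᵥ* Y = 0)
    (hu : ∀ d ∈ D, ∃ z : ℂ, ρ' d *ᵥ u = z • u ∧ star ξ ᵥ* ρ d = z • star ξ) :
    IsLinked D (blockRep ρ' ρ) (blockRep σ' σ) (addLink u ξ Y) where
  comm d hd c := by
    rw [Commute, SemiconjBy, blockRep_apply, blockRep_apply, fromBlocks_multiply,
      fromBlocks_multiply]
    simp [(h.comm d hd c).eq, (h' d hd c).eq]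
  sq := by
    rw [_root_.addLink, fromBlocks_multiply]
    simp [h.sq, vecMulVec_mul, hξ, ← fromBlocks_zero]
    ext; simp [vecMulVec_apply]
  link d hd := by
    obtain ⟨z, hz, hz'⟩ := hu d hd
    rw [Commute, SemiconjBy, blockRep_apply, _root_.addLink, fromBlocks_multiply,
      fromBlocks_multiply]
    simp [(h.link d hd).eq, vecMulVec_mul, mul_vecMulVec, hz, hz', smul_vecMulVec, vecMulVec_smul]

variable (v : κ → ℂ) (w : ι → ℂ) (u : κ → ℂ) (ξ : ι → ℂ)

theorem inl_vecMul_blockRep {R : Type*} [Ring R] [Algebra ℂ R] [StarRing R]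
    (π : R →⋆ₐ[ℂ] Matrix κ κ ℂ) (τ : R →⋆ₐ[ℂ] Matrix ι ι ℂ) (x : R) :
    Sum.elim v 0 ᵥ* blockRep π τ x = Sum.elim (v ᵥ* π x) (0 : ι → ℂ) := by
  rw [blockRep_apply, vecMul_fromBlocks]
  simp [Function.comp_def, ← Pi.zero_def]

theorem inr_vecMul_blockRep {R : Type*} [Ring R] [Algebra ℂ R] [StarRing R]
    (π : R →⋆ₐ[ℂ] Matrix κ κ ℂ) (τ : R →⋆ₐ[ℂ] Matrix ι ι ℂ) (x : R) :
    Sum.elim 0 w ᵥ* blockRep π τ x = Sum.elim (0 : κ → ℂ) (w ᵥ* τ x) := by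
  rw [blockRep_apply, vecMul_fromBlocks]
  simp [Function.comp_def, ← Pi.zero_def]

omit [DecidableEq κ] [DecidableEq ι] in
theorem inl_vecMul_addLink :
    Sum.elim v 0 ᵥ* addLink u ξ Y = Sum.elim (0 : κ → ℂ) ((v ⬝ᵥ u) • star ξ) := by
  rw [addLink, vecMul_fromBlocks]
  simp [Function.comp_def, ← Pi.zero_def, vecMul_vecMulVec]

omit [DecidableEq κ] [DecidableEq ι] in
theorem inr_vecMul_addLink : Sum.elim 0 w ᵥ* addLink u ξ Y =
    Sum.elim (0 : κ → ℂ) (w ᵥ* Y) := by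
  rw [addLink, vecMul_fromBlocks]
  simp [Function.comp_def, ← Pi.zero_def]

/-- Row vectors in the old summand do not see the added link: all matrices are block upper
triangular. -/
theorem inr_vecMul_leadingHom (y : TensorAlgebra ℂ (C × B)) :
    Sum.elim 0 w ᵥ* leadingHom (blockRep ρ' ρ) (blockRep σ' σ) (addLink u ξ Y) y =
      Sum.elim (0 : κ → ℂ) (w ᵥ* leadingHom ρ σ Y y) := by
  induction y using TensorAlgebra.induction generalizing w with
  | algebraMap r =>
    rw [AlgHom.commutes, AlgHom.commutes, Algebra.algebraMap_eq_smul_one,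
      Algebra.algebraMap_eq_smul_one, vecMul_smul, vecMul_smul, vecMul_one, vecMul_one]
    funext x; cases x <;> simp
  | ι x =>
    have hx : x = (x.1, 0) + (0, x.2) := by simp
    rw [hx, map_add, map_add, map_add, leadingHom_inl, leadingHom_inr, leadingHom_inl,
      leadingHom_inr, vecMul_add, vecMul_add, mul_neg, mul_neg, vecMul_neg, vecMul_neg,
      ← vecMul_vecMul, ← vecMul_vecMul, inr_vecMul_addLink, inr_vecMul_blockRep,
      inr_vecMul_addLink, inr_vecMul_blockRep, vecMul_vecMul, vecMul_vecMul]
    funext x; cases x <;> simp [mul_assoc]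
  | mul x y hx hy => rw [map_mul, map_mul, ← vecMul_vecMul, hx, hy, vecMul_vecMul]
  | add x y hx hy =>
    rw [map_add, map_add, vecMul_add, vecMul_add, hx, hy]
    funext x; cases x <;> simp

end AddLink

variable (D) in
/-- A combination of words is left null at `e` if the row vectors `⟨ξ|` with `ξ` in the range of
`ρ e` annihilate its leading coefficient for all linked representations.  If `strict` holds, only
the vectors with `⟨ξ| Y = 0` are considered. -/
def IsLeftNull (strict : Prop) (e : B) (z : TensorAlgebra ℂ (C × B)) : Prop :=
  ∀ (ι : Type) [Fintype ι] [DecidableEq ι] (ρ : B →⋆ₐ[ℂ] Matrix ι ι ℂ)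
    (σ : C →⋆ₐ[ℂ] Matrix ι ι ℂ) (Y : Matrix ι ι ℂ), IsLinked D ρ σ Y → ∀ ξ : ι → ℂ,
      ρ e *ᵥ ξ = ξ → (strict → star ξ ᵥ* Y = 0) → star ξ ᵥ* leadingHom ρ σ Y z = 0

theorem star_vecMul_of_mulVec_eq {R : Type*} [Ring R] [Algebra ℂ R] [StarRing R] {ι : Type}
    [Fintype ι] [DecidableEq ι] (ρ : R →⋆ₐ[ℂ] Matrix ι ι ℂ) {e : R} (he : star e = e) {ξ : ι → ℂ}
    (hξ : ρ e *ᵥ ξ = ξ) : star ξ ᵥ* ρ e = star ξ := by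
  conv_rhs => rw [← hξ, star_mulVec, ← star_eq_conjTranspose, ← map_star, he]

/-- Contraction of the first two letters by vector functionals preserves left nullity: a linked
representation for the contracted word is enlarged by one summand for each of the two letters. -/
theorem IsLeftNull.contract {strict : Prop} {p q : B} (hq : star q = q)
    (hqD : ∀ d ∈ D, ∃ z : ℂ, d * q = z • q ∧ q * d = z • q)
    {n : ℕ} {b : Fin n → B} {c : Fin n → C} {y : Fin n → TensorAlgebra ℂ (C × B)}
    (hz : IsLeftNull D strict p
      (∑ r, TensorAlgebra.ι ℂ (0, b r) * (TensorAlgebra.ι ℂ (c r, 0) * y r)))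
    {f : B →ₗ[ℂ] ℂ} (hf : f ∈ vectorFunctionals strict p q)
    {g : C →ₗ[ℂ] ℂ} (hg : g ∈ vectorFunctionals True 1 1) :
    IsLeftNull D True q (∑ r, (f (b r) * g (c r)) • y r) := by
  obtain ⟨m, _, _, π, α, β, hα, hβ, hαβ, hf⟩ := hf
  obtain ⟨n, _, _, τ, γ, δ, -, -, hγδ, hg⟩ := hg
  intro ι _ _ ρ σ Y hL ξ hξ hξY
  by_cases hβ0 : β = 0
  · have : ∀ x, f x = 0 := fun x => by rw [hf, hβ0]; simp
    simp [this]
  by_cases hγ0 : γ = 0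
  · have : ∀ x, g x = 0 := fun x => by rw [hg, hγ0]; simp
    simp [this]
  have hβ1 : star β ⬝ᵥ β ≠ 0 := fun h => hβ0 (dotProduct_star_self_eq_zero.1 h)
  have hγ1 : star γ ⬝ᵥ γ ≠ 0 := fun h => hγ0 (dotProduct_star_self_eq_zero.1 h)
  have hcomm : ∀ d ∈ D, ∀ c, Commute (ampLeft n π d) (ampRight m τ c) := fun d _ c =>
    commute_ampLeft_ampRight π τ d c
  -- the new vectors are in the range of `q`, where `D` acts by scalars
  have hscal : ∀ {κ : Type} [Fintype κ] [DecidableEq κ] (θ : B →⋆ₐ[ℂ] Matrix κ κ ℂ) (ζ : κ → ℂ),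
      θ q *ᵥ ζ = ζ → ∀ w : n → ℂ, ∀ d ∈ D, ∃ z : ℂ,
      ampLeft n π d *ᵥ vecTensor β w = z • vecTensor β w ∧ star ζ ᵥ* θ d = z • star ζ := by
    intro κ _ _ θ ζ hζ w d hd
    obtain ⟨z, hz, hz'⟩ := hqD d hd
    refine ⟨z, ?_, ?_⟩
    · rw [ampLeft_mulVec]
      conv_lhs => rw [← hβ, mulVec_mulVec, ← map_mul, hz, map_smul, smul_mulVec, hβ]
      funext a
      simp [vecTensor, mul_assoc]
    · conv_lhs => rw [← star_vecMul_of_mulVec_eq θ hq hζ, vecMul_vecMul, ← map_mul, hz', map_smul,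
        vecMul_smul, star_vecMul_of_mulVec_eq θ hq hζ]
  -- the summand for the letter from `C`
  have hL₁ := hL.addLink hcomm (u := vecTensor β δ) (hξY trivial) (hscal ρ ξ hξ δ)
  set Y₁ := addLink (vecTensor β δ) ξ Y
  let ξ₁ : (m × n) ⊕ ι → ℂ := Sum.elim (vecTensor β γ) 0
  have hstar : ∀ {κ ι : Type} (v : κ → ℂ),
      star (Sum.elim v (0 : ι → ℂ)) = Sum.elim (star v) 0 := by
    intro κ ι v; funext x; cases x <;> simp
  have hξ₁ : blockRep (ampLeft n π) ρ q *ᵥ ξ₁ = ξ₁ := by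
    rw [blockRep_apply, fromBlocks_mulVec]
    simp [ξ₁, Function.comp_def, ← Pi.zero_def, ampLeft_mulVec, hβ]
  have hξY₁ : star ξ₁ ᵥ* Y₁ = 0 := by
    rw [hstar, inl_vecMul_addLink, star_vecTensor_dotProduct, hγδ trivial]
    funext x; cases x <;> simp
  -- the summand for the letter from `B`
  have hL₂ := hL₁.addLink hcomm (u := vecTensor β γ) hξY₁ (hscal _ ξ₁ hξ₁ γ)
  set Y₂ := addLink (vecTensor β γ) ξ₁ Y₁
  let ξ₂ : (m × n) ⊕ ((m × n) ⊕ ι) → ℂ := Sum.elim (vecTensor α γ) 0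
  have h := hz _ _ _ _ hL₂ ξ₂ (by
    rw [blockRep_apply, fromBlocks_mulVec]
    simp [ξ₂, Function.comp_def, ← Pi.zero_def, ampLeft_mulVec, hα]) (fun hs => by
    rw [hstar, inl_vecMul_addLink, star_vecTensor_dotProduct, hαβ hs]
    funext x; cases x <;> simp)
  rw [map_sum, vecMul_sum] at h
  have hterm : ∀ r, star ξ₂ ᵥ* leadingHom (blockRep (ampLeft n π) (blockRep (ampLeft n π) ρ))
      (blockRep (ampRight m τ) (blockRep (ampRight m τ) σ)) Y₂
        (TensorAlgebra.ι ℂ (0, b r) * (TensorAlgebra.ι ℂ (c r, 0) * y r)) =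
      Sum.elim (0 : m × n → ℂ) (Sum.elim (0 : m × n → ℂ) (-(((star γ ⬝ᵥ γ) * (star β ⬝ᵥ β) *
        (f (b r) * g (c r))) • (star ξ ᵥ* leadingHom ρ σ Y (y r))))) := by
    intro r
    rw [map_mul, map_mul, leadingHom_inl, leadingHom_inr, ← vecMul_vecMul, ← vecMul_vecMul,
      ← vecMul_vecMul, ← vecMul_vecMul, hstar, inl_vecMul_blockRep, inl_vecMul_addLink,
      inr_vecMul_blockRep, vecMul_neg, inr_vecMul_addLink, smul_vecMul, smul_vecMul, hstar,
      inl_vecMul_blockRep, inl_vecMul_addLink, neg_vecMul, inr_vecMul_leadingHom, smul_vecMul,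
      inr_vecMul_leadingHom, smul_vecMul, ← dotProduct_mulVec, ← dotProduct_mulVec,
      ampLeft_mulVec, ampRight_mulVec, star_vecTensor_dotProduct, star_vecTensor_dotProduct,
      ← hf, ← hg]
    funext x
    rcases x with x | x | x
    · simp
    · simp
    · simp; ring
  rw [Finset.sum_congr rfl fun r _ => hterm r] at h
  have h' : ((star γ ⬝ᵥ γ) * (star β ⬝ᵥ β)) •
      (star ξ ᵥ* leadingHom ρ σ Y (∑ r, (f (b r) * g (c r)) • y r)) = 0 := by
    rw [map_sum, vecMul_sum, Finset.smul_sum, ← neg_eq_zero, ← Finset.sum_neg_distrib]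
    funext i
    have := congrFun h (Sum.inr (Sum.inr i))
    simpa [Finset.sum_apply, vecMul_smul, mul_assoc] using this
  exact (smul_eq_zero.1 h').resolve_left (mul_ne_zero hγ1 hβ1)

end Linked

/-! ### Reduction of word length -/

section Reduction

variable {B C : Type*} [Ring B] [Algebra ℂ B] [StarRing B] [Ring C] [Algebra ℂ C]
variable {D : NonUnitalStarSubalgebra ℂ B}

open FreeProdModComm

variable (C D) in
/-- The span of the words `c₀ b₀ c₁ b₁ ⋯ cₖ bₖ` in the quotient. -/
noncomputable def inlWordImage (k : ℕ) : Submodule ℂ (FreeProdModComm C D) :=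
  Submodule.span ℂ {x | ∃ c, ∃ y ∈ wordImage C D k, x = inl C D c * y}

theorem inl_mul_mem_inlWordImage (c : C) {k : ℕ} {y : FreeProdModComm C D}
    (hy : y ∈ wordImage C D k) : inl C D c * y ∈ inlWordImage C D k :=
  Submodule.subset_span ⟨c, y, hy, rfl⟩

theorem wordImage_le_inlWordImage (k : ℕ) : wordImage C D k ≤ inlWordImage C D k := fun x hx => by
  have := inl_mul_mem_inlWordImage 1 hx
  rwa [map_one, one_mul] at this

theorem inlWordImage_le_wordImage (k : ℕ) : inlWordImage C D k ≤ wordImage C D (k + 1) := by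
  refine Submodule.span_le.2 ?_
  rintro _ ⟨c, y, hy, rfl⟩
  exact inl_mul_mem c hy

theorem inl_mul_mem_of_mem_inlWordImage (c : C) {k : ℕ} {x : FreeProdModComm C D}
    (hx : x ∈ inlWordImage C D k) : inl C D c * x ∈ inlWordImage C D k := by
  induction hx using Submodule.span_induction with
  | mem x h =>
    obtain ⟨c', y, hy, rfl⟩ := h
    rw [← mul_assoc, ← map_mul]
    exact inl_mul_mem_inlWordImage _ hy
  | zero => rw [mul_zero]; exact zero_mem _
  | add x y _ _ hx hy => rw [mul_add]; exact add_mem hx hy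
  | smul t x _ hx => rw [mul_smul_comm]; exact Submodule.smul_mem _ _ hx

theorem inr_mul_mem_of_mem_inlWordImage {p : B} (hp : ∀ c, inl C D c * inr C D p =
    inr C D p * inl C D c) {k : ℕ} {x : FreeProdModComm C D} (hx : x ∈ inlWordImage C D k) :
    inr C D p * x ∈ inlWordImage C D k := by
  induction hx using Submodule.span_induction with
  | mem x h =>
    obtain ⟨c, y, hy, rfl⟩ := h
    rw [← mul_assoc, ← hp, mul_assoc]
    exact inl_mul_mem_inlWordImage _ (inr_mul_mem p hy)
  | zero => rw [mul_zero]; exact zero_mem _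
  | add x y _ _ hx hy => rw [mul_add]; exact add_mem hx hy
  | smul t x _ hx => rw [mul_smul_comm]; exact Submodule.smul_mem _ _ hx

variable (C D) in
/-- The words to which a left null combination of words with `k` letters from `C` reduces: for
general row vectors words with `k - 1` letters from `C`, and for the strict condition the same with
an additional letter from `C` in front.  For `k = 0` there are none. -/
noncomputable def shorterWords (strict : Prop) [Decidable strict] :
    ℕ → Submodule ℂ (FreeProdModComm C D)
  | 0 => ⊥
  | k + 1 => if strict then inlWordImage C D k else wordImage C D k

theorem inl_mul_mem_wordImage_of_mem_shorterWords (c : C) {k : ℕ} {x : FreeProdModComm C D}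
    (hx : x ∈ shorterWords C D True k) : inl C D c * x ∈ wordImage C D k := by
  cases k with
  | zero => rw [(Submodule.mem_bot ℂ).1 hx, mul_zero]; exact zero_mem _
  | succ k =>
    rw [shorterWords, if_pos trivial] at hx
    exact inlWordImage_le_wordImage k (inl_mul_mem_of_mem_inlWordImage c hx)

variable [StarRing C] {I : Type*} [Fintype I] {p : I → B}

/-- A left null combination of words reduces to shorter words, when compressed by the projection.
Contraction of the first two letters with vector functionals gives left null words again, which
reduce by induction.  As vector functionals separate `B` and `C` up to the scalars, the first
letters are then scalars on the projections, and they commute to the right. -/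
theorem inr_mul_ofWord_mem_shorterWords (hB : IsRFD B) (hC : IsRFD C)
    (hstar : ∀ i, star (p i) = p i) (hidem : ∀ i, p i * p i = p i)
    (hort : ∀ i j, i ≠ j → p i * p j = 0) (hsum : ∑ i, p i = 1)
    (hcomm : ∀ i c, inl C D c * inr C D (p i) = inr C D (p i) * inl C D c)
    (hD : ∀ d ∈ D, ∀ i, ∃ z : ℂ, d * p i = z • p i ∧ p i * d = z • p i) (k : ℕ) :
    ∀ (strict : Prop) [Decidable strict] (i : I) (z : TensorAlgebra ℂ (C × B)),
      z ∈ wordSpace B C k → IsLeftNull D strict (p i) z →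
        inr C D (p i) * ofWord C D z ∈ shorterWords C D strict k := by
  induction k with
  | zero =>
    intro strict _ i z hz hnull
    rw [shorterWords, Submodule.mem_bot]
    obtain ⟨b, rfl⟩ := hz
    have hb : (TensorAlgebra.ι ℂ ∘ₗ LinearMap.inr ℂ C B) b = TensorAlgebra.ι ℂ (0, b) := rfl
    rw [hb] at hnull ⊢
    rw [ofWord_inr, ← map_mul]
    by_cases hC1 : (1 : C) = 0
    · -- a degenerate case: if `C` is trivial, so is the quotient
      rw [← one_mul (inr C D (p i * b)), ← map_one (inl C D), hC1, map_zero, zero_mul]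
    obtain ⟨n, τ, hτ⟩ : ∃ (n : ℕ) (τ : C →⋆ₐ[ℂ] Matrix (Fin n) (Fin n) ℂ), τ 1 ≠ 0 := by
      by_contra! h
      exact hC1 (hC.eq_zero_of_isNull h)
    obtain ⟨γ, hγ⟩ : ∃ γ : Fin n → ℂ, star γ ⬝ᵥ γ ≠ 0 := by
      by_contra! h
      apply hτ
      ext a b
      have := congrFun (dotProduct_star_self_eq_zero.1 (h (Pi.single b 1))) b
      simp at this
    suffices h : p i * b * 1 = 0 by
      rw [← mul_one (p i * b), h, map_zero]
    refine mul_mul_eq_zero_of_vectorFunctionals (strict := False) hB (hstar i) (hidem i)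
      (mul_one 1) False.elim fun f hf => ?_
    obtain ⟨m, _, _, π, α, β, hα, -, -, hf⟩ := hf
    have h := hnull (m × Fin n) (ampLeft (Fin n) π) (ampRight m τ) 0
      ⟨fun d _ c => commute_ampLeft_ampRight π τ d c, mul_zero 0, fun _ _ => Commute.zero_right _⟩
      (vecTensor α γ) (by rw [ampLeft_mulVec, hα]) (fun _ => vecMul_zero _)
    rw [leadingHom_inr] at h
    have h1 := congrArg (fun v => v ⬝ᵥ vecTensor β γ) h
    simp only [zero_dotProduct] at h1
    rw [← dotProduct_mulVec, ampLeft_mulVec, star_vecTensor_dotProduct, ← hf] at h1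
    exact (mul_eq_zero.1 h1).resolve_right hγ
  | succ k ih =>
    intro strict _ i z hz hnull
    obtain ⟨n, b, c, y, hy, rfl⟩ := exists_sum_of_mem_wordSpace_succ hz
    have hpp : ∀ j, inr C D (p j) * inr C D (p j) = inr C D (p j) := fun j => by
      rw [← map_mul, hidem]
    -- contraction of both letters
    have h1 : ∀ j, ∀ f ∈ vectorFunctionals strict (p i) (p j),
        ∀ g ∈ vectorFunctionals (R := C) True 1 1,
        ∑ r, g (c r) • (f (b r) • (inr C D (p j) * ofWord C D (y r))) ∈
          shorterWords C D True k := by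
      intro j f hf g hg
      have := ih True j _ (sum_mem fun r _ => Submodule.smul_mem _ _ (hy r))
        (hnull.contract (hstar j) (fun d hd => hD d hd j) hf hg)
      rw [map_sum, Finset.mul_sum] at this
      simpa only [map_smul, mul_smul_comm, smul_smul, mul_comm] using this
    -- restoration of the letter from `C`
    have h2 : ∀ j, ∀ f ∈ vectorFunctionals strict (p i) (p j),
        ∑ r, f (b r) • (inl C D (c r) * (inr C D (p j) * ofWord C D (y r))) ∈
          wordImage C D k := by
      intro j f hf
      have := sum_mem_of_forall_functional (F := vectorFunctionals (R := C) True 1 1)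
        (P := wordImage C D k) (Q := shorterWords C D True k) (R := wordImage C D k)
        ((LinearMap.mul ℂ (FreeProdModComm C D)).comp (inl C D).toLinearMap) c
        (fun r => f (b r) • (inr C D (p j) * ofWord C D (y r)))
        (fun r => Submodule.smul_mem _ _ (inr_mul_mem _ (ofWord_mem_wordImage (hy r))))
        (fun g hg => h1 j f hf g hg) (fun x hx w hw => ?_)
        (fun x w hw => inl_mul_mem_wordImage_of_mem_shorterWords x hw)
      · simpa using this
      · obtain ⟨t, ht⟩ := exists_mul_mul_eq_smul_of_vectorFunctionals hC (star_one C) (mul_one 1) hx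
        rw [one_mul, mul_one] at ht
        rw [ht]
        simpa using Submodule.smul_mem _ t hw
    -- restoration of the letter from `B`
    have h3 : ∀ j, ∑ r, inr C D (p i) * (inr C D (b r) * (inr C D (p j) *
        (inl C D (c r) * (inr C D (p j) * ofWord C D (y r))))) ∈
          shorterWords C D strict (k + 1) := by
      intro j
      have hT : ∀ x w, (((LinearMap.mul ℂ (FreeProdModComm C D)).comp
        ((LinearMap.mulLeft ℂ (inr C D (p i))).comp
        ((LinearMap.mulRight ℂ (inr C D (p j))).comp (inr C D).toLinearMap))) x w) =
          inr C D (p i * x * p j) * w := fun x w => by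
        simp [mul_assoc]
      have := sum_mem_of_forall_functional (F := vectorFunctionals strict (p i) (p j))
        (P := inlWordImage C D k) (Q := wordImage C D k) (R := shorterWords C D strict (k + 1))
        ((LinearMap.mul ℂ (FreeProdModComm C D)).comp ((LinearMap.mulLeft ℂ (inr C D (p i))).comp
        ((LinearMap.mulRight ℂ (inr C D (p j))).comp (inr C D).toLinearMap))) b
        (fun r => inl C D (c r) * (inr C D (p j) * ofWord C D (y r)))
        (fun r => inl_mul_mem_inlWordImage _ (inr_mul_mem _ (ofWord_mem_wordImage (hy r))))
        (fun f hf => h2 j f hf) (fun x hx w hw => ?_) (fun x w hw => ?_)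
      · simp only [hT] at this
        simpa [mul_assoc] using this
      · rw [hT]
        by_cases hs : strict
        · rw [shorterWords, if_pos hs]
          by_cases hij : i = j
          · subst hij
            have hs' : strict = True := eq_true hs
            obtain ⟨t, ht⟩ := exists_mul_mul_eq_smul_of_vectorFunctionals hB (hstar i) (hidem i)
              (x := x) (fun f hf => hx f (by rwa [hs']))
            rw [ht, map_smul, smul_mul_assoc]
            exact Submodule.smul_mem _ _ (inr_mul_mem_of_mem_inlWordImage (hcomm i) hw)
          · rw [mul_mul_eq_zero_of_vectorFunctionals hB (hstar i) (hidem i) (hidem j)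
              (fun _ => hort i j hij) hx, map_zero, zero_mul]
            exact zero_mem _
        · rw [mul_mul_eq_zero_of_vectorFunctionals hB (hstar i) (hidem i) (hidem j)
            (fun h => (hs h).elim) hx, map_zero, zero_mul]
          exact zero_mem _
      · rw [hT, shorterWords]
        split_ifs
        · exact wordImage_le_inlWordImage k (inr_mul_mem _ hw)
        · exact inr_mul_mem _ hw
    have h4 := sum_mem fun j (_ : j ∈ Finset.univ) => h3 j
    rw [Finset.sum_comm] at h4
    convert h4 using 1
    rw [map_sum, Finset.mul_sum]
    refine Finset.sum_congr rfl fun r _ => ?_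
    rw [ofWord_mul_mul, ← Finset.mul_sum, ← Finset.mul_sum]
    have : ∀ j, inr C D (p j) * (inl C D (c r) * (inr C D (p j) * ofWord C D (y r))) =
        inr C D (p j) * (inl C D (c r) * ofWord C D (y r)) := fun j => by
      rw [← mul_assoc (inl C D (c r)), hcomm, mul_assoc, ← mul_assoc, hpp]
    rw [Finset.sum_congr rfl fun j _ => this j, ← Finset.sum_mul, ← map_sum, hsum, map_one,
      one_mul]

/-- The theorem for an arbitrary residually finite-dimensional algebra `C`. -/
theorem IsRFD.freeProdModComm [StarModule ℂ B] [StarModule ℂ C] (hB : IsRFD B) (hC : IsRFD C)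
    [FiniteDimensional ℂ D] (hD : ∀ x ∈ D, ∀ y ∈ D, x * y = y * x) :
    IsRFD (FreeProdModComm C D) := by
  obtain ⟨I, _, p, hstar, hidem, hort, hsum, hmem, hscal⟩ := exists_projections hB D hD
  have hcomm : ∀ i c, inl C D c * inr C D (p i) = inr C D (p i) * inl C D c := by
    intro i c
    obtain ⟨z, d, hd, hp⟩ := hmem i
    rw [hp, map_add, mul_add, add_mul, AlgHom.commutes, inl_mul_inr c hd, Algebra.commutes]
  refine IsRFD.of_isNull fun x hx => ?_
  obtain ⟨k, hk⟩ := exists_mem_wordImage x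
  have key : ∀ k, x ∈ wordImage C D k → x ∈ shorterWords C D False k := by
    rintro k ⟨z, hz, rfl⟩
    rw [← one_mul ((ofWord C D).toLinearMap z), ← map_one (inr C D), ← hsum, map_sum,
      Finset.sum_mul]
    refine sum_mem fun i _ => inr_mul_ofWord_mem_shorterWords hB hC hstar hidem hort hsum hcomm
      hscal k False i z hz ?_
    intro ι _ _ ρ σ Y hL ξ _ _
    rw [hL.leadingHom_eq_zero hz hx, vecMul_zero]
  induction k with
  | zero => exact (Submodule.mem_bot ℂ).1 (key 0 hk)
  | succ k ih =>
    have := key (k + 1) hk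
    rw [shorterWords, if_neg not_false] at this
    exact ih this

end Reduction

theorem proposition2p15 {B C : Type*}
    [Ring B] [Algebra ℂ B] [StarRing B] [StarModule ℂ B] (hB : IsRFD B)
    (D : NonUnitalStarSubalgebra ℂ B) [FiniteDimensional ℂ D]
    (hD : ∀ x ∈ D, ∀ y ∈ D, x * y = y * x)
    [CStarAlgebra C] [FiniteDimensional ℂ C] :
    IsRFD (FreeProdModComm C D) :=
  hB.freeProdModComm isRFD_of_finiteDimensional hD
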